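/- Let $X$ be a compact connected Riemann surface with holomorphic cotangent bundle $K_X$, and let $n\ge 2$, $m\ge 2$ be integers. A generalized $\mathrm{SO}(2n,\mathbb C)$-quasioper of length $2m+1$ on $X$ is a quadruple $(E,B_0,\mathcal F_\bullet,D)$ of the following kind. $E$ is a holomorphic vector bundle of rank $2n$ on $X$ with $\det E\cong\mathcal O_X$, and $B_0\in H^0(X,\mathrm{Sym}^2(E^*))$ is fiberwise nondegenerate. $\mathcal F_\bullet$ is a filtration $0=F_0\subset F_1\subset\cdots\subset F_{2m+1}=E$ by holomorphic subbundles with $\operatorname{rank}(F_{m+1}/F_m)=2\operatorname{rank}(F_1)$, $\operatorname{rank}(F_i/F_{i-1})=\operatorname{rank}(F_1)$ for $i\in\{1,\dots,2m+1\}\setminus\{m+1\}$, and $F_i^{\perp}=F_{2m+1-i}$ for $0\le i\le m$. $D:E\to E\otimes K_X$ is a holomorphic connection with $d\,B_0(s,t)=B_0(Ds,t)+B_0(s,Dt)$ for local holomorphic sections $s,t$ of $E$ and $D(F_i)\subset F_{i+1}\otimes K_X$ for $1\le i\le 2m$, such that the second fundamental form $S(D,i):F_i/F_{i-1}\to(F_{i+1}/F_i)\otimes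 K_X$ is an isomorphism for $i\in\{1,\dots,2m\}\setminus\{m,m+1\}$ and the composition $(S(D,m+1)\otimes\mathrm{Id}_{K_X})\circ S(D,m):F_m/F_{m-1}\to(F_{m+2}/F_{m+1})\otimes K_X^{\otimes 2}$ is an isomorphism. For a holomorphic vector bundle $W$ with a holomorphic connection $D_W$ and a holomorphic subbundle $V\subset W$, let $\widehat D_W(V)$ be the smallest holomorphic subbundle of $W$ that contains $V$ and satisfies $D_W(V)\subset\widehat D_W(V)\otimes K_X$; let $\widehat D_W^{k}(V)$ be its $k$-fold iterate. Given a generalized $\mathrm{SO}(2n,\mathbb C)$-quasioper $(E,B_0,\mathcal F_\bullet,D)$ of length $2m+1$, put $\mathbb F:=\widehat D_E^{2m}(F_1)\subset E$. Let $D^*$ be the connection on $E^*$ induced by $D$, let $G_1\subset E^*$ be the kernel of the restriction map $E^*\to F_{2m}^*$, put $\mathbb G:=\widehat{(D^*)}_{E^*}^{2m}(G_1)\subset E^*$, and let $\mathcal S:=(E^*/\mathbb G)^*\subset E^{**}=E$ be the image of the dual of the quotient map $E^*\to E^*/\mathbb G$. Then the iterated saturations $\widehat D_E^{k}(F_1)$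 and $\widehat{(D^*)}_{E^*}^{k}(G_1)$, $1\le k\le 2m$, exist; $\mathbb F$ and $\mathcal S$ are holomorphic subbundles of $E$; the natural homomorphism $\mathbb F\oplus\mathcal S\to E$ is an isomorphism of holomorphic vector bundles; and the resulting decomposition $E=\mathbb F\oplus\mathcal S$ is orthogonal with respect to $B_0$. -/

import Mathlib

open Bundle
open scoped Manifold ContDiff Topology

noncomputable section

namespace SOQuasioper

section Bundles

/-! Throughout, `X` is a complex one-dimensional manifold (charts in `ℂ`, analytic transition maps)
and `E` is a holomorphic vector bundle over `X` with model fibre `F`. "Holomorphic" is spelled as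
`C^ω` over `ℂ`. A local section over `U` is a section `s : Π x, E x` of which only the values on `U`
matter. -/

variable {X : Type*} [TopologicalSpace X] [ChartedSpace ℂ X]
  (F : Type*) [NormedAddCommGroup F] [NormedSpace ℂ F]
  {E : X → Type*} [TopologicalSpace (TotalSpace F E)]
  [∀ x, AddCommGroup (E x)] [∀ x, Module ℂ (E x)] [∀ x, TopologicalSpace (E x)]
  [∀ x, IsTopologicalAddGroup (E x)] [∀ x, ContinuousSMul ℂ (E x)]
  [FiberBundle F E]

/-- `s` is a holomorphic section of `E` over `U`. -/
def IsHolSection (U : Set X) (s : Π x, E x) : Prop :=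
  ContMDiffOn 𝓘(ℂ) (𝓘(ℂ).prod 𝓘(ℂ, F)) ω (fun x ↦ TotalSpace.mk' F x (s x)) U

/-- A family of subspaces of the fibres is a holomorphic subbundle if, locally on `X`, it has
a holomorphic frame. -/
def IsHolSubbundle (V : Π x, Submodule ℂ (E x)) : Prop :=
  ∀ x₀ : X, ∃ U : Set X, IsOpen U ∧ x₀ ∈ U ∧ ∃ (k : ℕ) (s : Fin k → Π x, E x),
    (∀ i, IsHolSection F U (s i)) ∧
    ∀ x ∈ U, LinearIndependent ℂ (fun i ↦ s i x) ∧
      Submodule.span ℂ (Set.range fun i ↦ s i x) = V x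

/-- `D` takes `V` into `W ⊗ K_X`: for every holomorphic section `s` of `V` over an open set `U`,
the `1`-form `D s` takes values in `W` on `U`. -/
def MapsInto (D : CovariantDerivative 𝓘(ℂ) F E) (V W : Π x, Submodule ℂ (E x)) : Prop :=
  ∀ (U : Set X) (s : Π x, E x), IsOpen U → IsHolSection F U s → (∀ x ∈ U, s x ∈ V x) →
    ∀ x ∈ U, ∀ v : TangentSpace 𝓘(ℂ) x, D s x v ∈ W x

/-- The holomorphic subbundles `W ⊇ V` such that `D` takes `V` into `W ⊗ K_X`. -/
def saturations (D : CovariantDerivative 𝓘(ℂ) F E) (V : Π x, Submodule ℂ (E x)) :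
    Set (Π x, Submodule ℂ (E x)) :=
  {W | IsHolSubbundle F W ∧ V ≤ W ∧ MapsInto F D V W}

/-- The minimal `D`-saturation of `V`, the smallest holomorphic subbundle `W ⊇ V` such that
`D` takes `V` into `W ⊗ K_X`. It is written as the fibrewise intersection of all of these
subbundles, which is the smallest one of them as soon as it is a holomorphic subbundle
(see `isLeast_saturation`). -/
def saturation (D : CovariantDerivative 𝓘(ℂ) F E) (V : Π x, Submodule ℂ (E x)) :
    Π x, Submodule ℂ (E x) :=
  sInf (saturations F D V)

theorem isLeast_saturation (D : CovariantDerivative 𝓘(ℂ) F E) (V : Π x, Submodule ℂ (E x))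
    (h : IsHolSubbundle F (saturation F D V)) :
    IsLeast (saturations F D V) (saturation F D V) := by
  refine ⟨⟨h, le_sInf fun W hW ↦ hW.2.1, ?_⟩, fun W hW ↦ sInf_le hW⟩
  intro U s hU hs hsV x hx v
  simp only [saturation, sInf_apply, Submodule.mem_iInf]
  exact fun W ↦ W.2.2.2 U s hU hs hsV x hx v

/-- Conversely, a least element of `saturations` is the saturation. -/
theorem saturation_eq_of_isLeast (D : CovariantDerivative 𝓘(ℂ) F E)
    (V W : Π x, Submodule ℂ (E x)) (h : IsLeast (saturations F D V) W) :
    saturation F D V = W :=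
  h.isGLB.sInf_eq

/-- The iterated saturation `D̂^k(V)`. -/
def iterSaturation (D : CovariantDerivative 𝓘(ℂ) F E) (k : ℕ) (V : Π x, Submodule ℂ (E x)) :
    Π x, Submodule ℂ (E x) :=
  (saturation F D)^[k] V

/-- `D` is a holomorphic connection: it takes holomorphic sections of `E` over an open set to
holomorphic sections of `E ⊗ K_X = Hom(TX, E)`. (Additivity and the Leibniz identity are part of
`CovariantDerivative`.) -/
def IsHolConnection [IsManifold 𝓘(ℂ) 1 X] [VectorBundle ℂ F E]
    (D : CovariantDerivative 𝓘(ℂ) F E) : Prop :=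
  ∀ U : Set X, IsOpen U → ContMDiffCovariantDerivativeOn F ω D U

/-- The quotient `V / W` of two subspaces `W ⊆ V` of a vector space. -/
abbrev quot {A : Type*} [AddCommGroup A] [Module ℂ A] (V W : Submodule ℂ A) : Type _ :=
  ↥V ⧸ W.submoduleOf V

/-- `φ` is the fibre at `x` of the second fundamental form
`F₂ / F₁ → (F₄ / F₃) ⊗ K_X = Hom(TX, F₄ / F₃)`: it sends the class of `s x` to the class of
`D s` at `x`, for all local holomorphic sections `s` of `F₂`. As every vector of `F₂ x` is the value
of such an `s`, there is at most one such `φ`. -/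
def IsSecondFundamentalForm (D : CovariantDerivative 𝓘(ℂ) F E)
    (F₁ F₂ F₃ F₄ : Π x, Submodule ℂ (E x)) (x : X)
    (φ : quot (F₂ x) (F₁ x) →ₗ[ℂ] TangentSpace 𝓘(ℂ) x →ₗ[ℂ] quot (F₄ x) (F₃ x)) : Prop :=
  ∀ (U : Set X) (s : Π y, E y) (hx : x ∈ U), IsOpen U → IsHolSection F U s →
    ∀ (hs : ∀ y ∈ U, s y ∈ F₂ y) (v : TangentSpace 𝓘(ℂ) x),
      ∃ h : D s x v ∈ F₄ x,
        φ (Submodule.Quotient.mk ⟨s x, hs x hx⟩) v = Submodule.Quotient.mk ⟨D s x v, h⟩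

/-- `E` is, as a holomorphic vector bundle, the direct sum of its subbundles `P` and `Q`: the natural
homomorphism `P ⊕ Q → E` is bijective on each fibre and on holomorphic sections over each open
set. -/
structure IsHolDirectSum (P Q : Π x, Submodule ℂ (E x)) : Prop where
  subbundle_left : IsHolSubbundle F P
  subbundle_right : IsHolSubbundle F Q
  bijective : ∀ x, Function.Bijective ((P x).subtype.coprod (Q x).subtype)
  sections : ∀ (U : Set X) (s : Π x, E x), IsOpen U → IsHolSection F U s →
    ∃ a b : Π x, E x, IsHolSection F U a ∧ IsHolSection F U b ∧
      ∀ x ∈ U, a x ∈ P x ∧ b x ∈ Q x ∧ a x + b x = s x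

end Bundles

section Dual

variable {X : Type*} [TopologicalSpace X] [ChartedSpace ℂ X]
  {F : Type*} [NormedAddCommGroup F] [NormedSpace ℂ F]
  {E : X → Type*} [TopologicalSpace (TotalSpace F E)]
  [∀ x, AddCommGroup (E x)] [∀ x, Module ℂ (E x)] [∀ x, TopologicalSpace (E x)]
  [∀ x, IsTopologicalAddGroup (E x)] [∀ x, ContinuousSMul ℂ (E x)]
  [FiberBundle F E] [VectorBundle ℂ F E]

/-- The dual bundle `E*`, with model fibre `F →L[ℂ] ℂ`. -/
abbrev DualBundle (E : X → Type*) [∀ x, AddCommGroup (E x)] [∀ x, Module ℂ (E x)]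
    [∀ x, TopologicalSpace (E x)] : X → Type _ :=
  fun x ↦ E x →L[ℂ] Bundle.Trivial X ℂ x

/-- The natural pairing of a section of `E*` with a section of `E`. -/
def pairing (φ : Π x, DualBundle E x) (s : Π x, E x) : X → ℂ :=
  fun x ↦ φ x (s x)

theorem mdifferentiableAt_pairing {φ : Π x, DualBundle E x} {s : Π x, E x} {x : X}
    (hφ : MDiffAt (fun y ↦ TotalSpace.mk' (F →L[ℂ] ℂ) (E := DualBundle E) y (φ y)) x)
    (hs : MDiffAt (T% s) x) :
    MDiffAt (pairing φ s) x := by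
  have h := MDifferentiableAt.clm_bundle_apply (F₁ := F) (F₂ := ℂ) (E₂ := Bundle.Trivial X ℂ)
    (b := fun y : X ↦ y) (ϕ := φ) (v := s) hφ hs
  rw [mdifferentiableAt_totalSpace] at h
  exact h.2

/-- For a section `φ` of `E*`, the operation `s ↦ d(φ(s)) - φ(D s)` at `x`. -/
def dualConnectionAux (D : CovariantDerivative 𝓘(ℂ) F E) (φ : Π x, DualBundle E x) (x : X)
    (s : Π x, E x) : TangentSpace 𝓘(ℂ) x →L[ℂ] ℂ :=
  mvfderiv 𝓘(ℂ) (pairing φ s) x - (φ x : E x →L[ℂ] ℂ) ∘L D s x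

theorem tensorialAt_dualConnectionAux (D : CovariantDerivative 𝓘(ℂ) F E)
    (φ : Π x, DualBundle E x) (x : X)
    (hφ : MDiffAt (fun y ↦ TotalSpace.mk' (F →L[ℂ] ℂ) (E := DualBundle E) y (φ y)) x)
    (v : TangentSpace 𝓘(ℂ) x) :
    TensorialAt 𝓘(ℂ) F (fun s ↦ dualConnectionAux D φ x s v) x where
  smul {f s} hf hs := by
    have h1 : pairing φ (f • s) = f * pairing φ s := by
      ext y; simp [pairing]
    simp only [dualConnectionAux, h1, mvfderiv_mul hf (mdifferentiableAt_pairing hφ hs),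
      D.isCovariantDerivativeOnUniv.leibniz hs hf]
    simp [pairing]
    ring
  add {s s'} hs hs' := by
    have h1 : pairing φ (s + s') = pairing φ s + pairing φ s' := by
      ext y; simp [pairing]
    simp only [dualConnectionAux, h1, mvfderiv_add (mdifferentiableAt_pairing hφ hs)
      (mdifferentiableAt_pairing hφ hs'), D.isCovariantDerivativeOnUniv.add hs hs']
    simp
    ring

variable [FiniteDimensional ℂ F] [ContMDiffVectorBundle 1 F E 𝓘(ℂ)]

open Classical in
/-- The underlying function of the connection `D*` on `E*` induced by `D`: at a point `x` where the
section `φ` is differentiable, `(D* φ)(s) = d(φ(s)) - φ(D s)` (see `dualConnection_apply`). -/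
def dualConnectionFun (D : CovariantDerivative 𝓘(ℂ) F E) (φ : Π x, DualBundle E x) (x : X) :
    TangentSpace 𝓘(ℂ) x →L[ℂ] DualBundle E x :=
  if hφ : MDiffAt (fun y ↦ TotalSpace.mk' (F →L[ℂ] ℂ) (E := DualBundle E) y (φ y)) x then
    haveI : T2Space (TangentSpace 𝓘(ℂ) x) := inferInstanceAs (T2Space ℂ)
    haveI : FiniteDimensional ℂ (TangentSpace 𝓘(ℂ) x) := inferInstanceAs (FiniteDimensional ℂ ℂ)
    LinearMap.toContinuousLinearMap
      { toFun := fun v ↦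
          TensorialAt.mkHom (A := ℂ) (fun s ↦ dualConnectionAux D φ x s v) x
            (tensorialAt_dualConnectionAux D φ x hφ v)
        map_add' := fun v w ↦ by
          ext e
          simp only [TensorialAt.mkHom_apply_eq_extend, add_apply]
          exact map_add _ v w
        map_smul' := fun c v ↦ by
          ext e
          simp only [TensorialAt.mkHom_apply_eq_extend, smul_apply]
          exact map_smul _ c v }
  else 0

theorem dualConnectionFun_apply (D : CovariantDerivative 𝓘(ℂ) F E) {φ : Π x, DualBundle E x}
    {s : Π x, E x} {x : X}
    (hφ : MDiffAt (fun y ↦ TotalSpace.mk' (F →L[ℂ] ℂ) (E := DualBundle E) y (φ y)) x)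
    (hs : MDiffAt (T% s) x) (v : TangentSpace 𝓘(ℂ) x) :
    dualConnectionFun D φ x v (s x) = mvfderiv 𝓘(ℂ) (pairing φ s) x v - φ x (D s x v) := by
  rw [dualConnectionFun, dif_pos hφ]
  exact TensorialAt.mkHom_apply (tensorialAt_dualConnectionAux D φ x hφ v) hs

/-- The connection `D*` on the dual bundle `E*` induced by a connection `D` on `E`. -/
def dualConnection (D : CovariantDerivative 𝓘(ℂ) F E) :
    CovariantDerivative 𝓘(ℂ) (F →L[ℂ] ℂ) (DualBundle E) where
  toFun := dualConnectionFun D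
  isCovariantDerivativeOnUniv :=
    { add := by
        intro φ ψ x hφ hψ _
        refine ContinuousLinearMap.ext fun v ↦ ContinuousLinearMap.ext fun e ↦ ?_
        have hs : MDiffAt (T% (FiberBundle.extend F e)) x :=
          FiberBundle.mdifferentiableAt_extend ..
        have he : FiberBundle.extend F e x = e := by simp
        have h1 : pairing (φ + ψ) (FiberBundle.extend F e) =
            pairing φ (FiberBundle.extend F e) + pairing ψ (FiberBundle.extend F e) := by
          ext y; simp [pairing]
        have hφψ : MDiffAt (fun y ↦ TotalSpace.mk' (F →L[ℂ] ℂ) (E := DualBundle E) y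
            ((φ + ψ) y)) x := mdifferentiableAt_add_section hφ hψ
        rw [← he]
        simp only [add_apply]
        rw [dualConnectionFun_apply D hφψ hs, dualConnectionFun_apply D hφ hs,
          dualConnectionFun_apply D hψ hs, h1,
          mvfderiv_add (mdifferentiableAt_pairing hφ hs) (mdifferentiableAt_pairing hψ hs)]
        simp
        ring
      leibniz := by
        intro φ g x hφ hg _
        refine ContinuousLinearMap.ext fun v ↦ ContinuousLinearMap.ext fun e ↦ ?_
        have hs : MDiffAt (T% (FiberBundle.extend F e)) x :=
          FiberBundle.mdifferentiableAt_extend ..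
        have he : FiberBundle.extend F e x = e := by simp
        change dualConnectionFun D (fun y ↦ g y • φ y) x v e = _
        have h1 : pairing (fun y ↦ g y • φ y) (FiberBundle.extend F e) =
            g * pairing φ (FiberBundle.extend F e) := by
          ext y; simp [pairing]
        have hgφ : MDiffAt (fun y ↦ TotalSpace.mk' (F →L[ℂ] ℂ) (E := DualBundle E) y
            (g y • φ y)) x := MDifferentiableAt.smul_section hg hφ
        rw [← he]
        simp only [add_apply, smul_apply]
        rw [dualConnectionFun_apply D hgφ hs, dualConnectionFun_apply D hφ hs, h1,
          mvfderiv_mul hg (mdifferentiableAt_pairing hφ hs)]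
        simp [pairing]
        ring }

/-- The defining property of the dual connection: `d(φ(s)) = (D* φ)(s) + φ(D s)`. -/
theorem dualConnection_apply (D : CovariantDerivative 𝓘(ℂ) F E) {φ : Π x, DualBundle E x}
    {s : Π x, E x} {x : X}
    (hφ : MDiffAt (fun y ↦ TotalSpace.mk' (F →L[ℂ] ℂ) (E := DualBundle E) y (φ y)) x)
    (hs : MDiffAt (T% s) x) (v : TangentSpace 𝓘(ℂ) x) :
    dualConnection D φ x v (s x) = mvfderiv 𝓘(ℂ) (pairing φ s) x v - φ x (D s x v) :=
  dualConnectionFun_apply D hφ hs v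

end Dual

section Quasioper

variable {X : Type*} [TopologicalSpace X] [ChartedSpace ℂ X] [IsManifold 𝓘(ℂ) ω X]
  (F : Type*) [NormedAddCommGroup F] [NormedSpace ℂ F] [FiniteDimensional ℂ F]
  (E : X → Type*) [TopologicalSpace (TotalSpace F E)]
  [∀ x, AddCommGroup (E x)] [∀ x, Module ℂ (E x)] [∀ x, TopologicalSpace (E x)]
  [∀ x, IsTopologicalAddGroup (E x)] [∀ x, ContinuousSMul ℂ (E x)]
  [FiberBundle F E] [VectorBundle ℂ F E] [ContMDiffVectorBundle ω F E 𝓘(ℂ)]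

variable {E} in
/-- `E` has rank `2n`, its determinant is trivial, and `B` is an `SO(2n, ℂ)` structure on `E`. -/
structure IsSOStructure (n : ℕ) (B : Π x, E x →L[ℂ] E x →L[ℂ] ℂ) : Prop where
  rank_eq : Module.finrank ℂ F = 2 * n
  /-- `det E` is holomorphically trivial: there is a nowhere vanishing holomorphic section of the
  dual line bundle of `⋀^{2n} E`. -/
  det_trivial : ∃ vol : Π x, E x [⋀^Fin (2 * n)]→ₗ[ℂ] ℂ, (∀ x, vol x ≠ 0) ∧
    ∀ (U : Set X) (s : Fin (2 * n) → Π x, E x), IsOpen U → (∀ i, IsHolSection F U (s i)) →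
      ContMDiffOn 𝓘(ℂ) 𝓘(ℂ) ω (fun x ↦ vol x fun i ↦ s i x) U
  holomorphic : ContMDiff 𝓘(ℂ) (𝓘(ℂ).prod 𝓘(ℂ, F →L[ℂ] F →L[ℂ] ℂ)) ω
    (fun x ↦ TotalSpace.mk' (F →L[ℂ] F →L[ℂ] ℂ)
      (E := fun x ↦ E x →L[ℂ] E x →L[ℂ] Bundle.Trivial X ℂ x) x (B x))
  symm : ∀ x (e f : E x), B x e f = B x f e
  nondegenerate : ∀ x (e : E x), (∀ f : E x, B x f e = 0) → e = 0

variable {E} in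
/-- `0 = Fil 0 ⊆ Fil 1 ⊆ ⋯ ⊆ Fil (2m+1) = E` is a filtration of the `SO(2n, ℂ)`-bundle `(E, B)`
of length `2m+1`. The values `Fil i` for `i > 2m+1` play no role. -/
structure IsFiltration (B : Π x, E x →L[ℂ] E x →L[ℂ] ℂ) (m : ℕ)
    (Fil : ℕ → Π x, Submodule ℂ (E x)) : Prop where
  subbundle : ∀ i ≤ 2 * m + 1, IsHolSubbundle F (Fil i)
  zero : ∀ x, Fil 0 x = ⊥
  top : ∀ x, Fil (2 * m + 1) x = ⊤
  mono : ∀ i ≤ 2 * m, ∀ x, Fil i x ≤ Fil (i + 1) x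
  rank_middle : ∀ x, Module.finrank ℂ (quot (Fil (m + 1) x) (Fil m x)) =
    2 * Module.finrank ℂ (Fil 1 x)
  rank_other : ∀ i ≤ 2 * m, i ≠ m → ∀ x,
    Module.finrank ℂ (quot (Fil (i + 1) x) (Fil i x)) = Module.finrank ℂ (Fil 1 x)
  perp : ∀ i ≤ m, ∀ x (e : E x), (∀ f ∈ Fil i x, B x f e = 0) ↔ e ∈ Fil (2 * m + 1 - i) x

variable {E} in
/-- `D` is a holomorphic connection on the filtered `SO(2n, ℂ)`-bundle `(E, B, Fil)`. -/
structure IsFilteredConnection (B : Π x, E x →L[ℂ] E x →L[ℂ] ℂ) (m : ℕ)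
    (Fil : ℕ → Π x, Submodule ℂ (E x)) (D : CovariantDerivative 𝓘(ℂ) F E) : Prop where
  holomorphic : IsHolConnection F D
  /-- `D` preserves `B`. -/
  compatible : ∀ (U : Set X) (s t : Π x, E x), IsOpen U → IsHolSection F U s →
    IsHolSection F U t → ∀ x ∈ U, ∀ v : TangentSpace 𝓘(ℂ) x,
      mvfderiv 𝓘(ℂ) (fun y ↦ B y (s y) (t y)) x v = B x (D s x v) (t x) + B x (s x) (D t x v)
  mapsInto : ∀ i, 1 ≤ i → i ≤ 2 * m → MapsInto F D (Fil i) (Fil (i + 1))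
  /-- The second fundamental form `S(D, i) : F_i / F_{i-1} → (F_{i+1} / F_i) ⊗ K_X` is an
  isomorphism for `i ≠ m, m + 1`. -/
  second_iso : ∀ i, 1 ≤ i → i ≤ 2 * m → i ≠ m → i ≠ m + 1 → ∀ x,
    ∃ φ : quot (Fil i x) (Fil (i - 1) x) →ₗ[ℂ]
        TangentSpace 𝓘(ℂ) x →ₗ[ℂ] quot (Fil (i + 1) x) (Fil i x),
      IsSecondFundamentalForm F D (Fil (i - 1)) (Fil i) (Fil i) (Fil (i + 1)) x φ ∧
        Function.Bijective φ
  /-- The composition of `S(D, m)` and `S(D, m + 1) ⊗ Id`, from `F_m / F_{m-1}` to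
  `(F_{m+2} / F_{m+1}) ⊗ K_X ⊗ K_X = Hom(TX, Hom(TX, F_{m+2} / F_{m+1}))`, is an isomorphism. -/
  second_comp_iso : ∀ x,
    ∃ (φ : quot (Fil m x) (Fil (m - 1) x) →ₗ[ℂ]
        TangentSpace 𝓘(ℂ) x →ₗ[ℂ] quot (Fil (m + 1) x) (Fil m x))
      (ψ : quot (Fil (m + 1) x) (Fil m x) →ₗ[ℂ]
        TangentSpace 𝓘(ℂ) x →ₗ[ℂ] quot (Fil (m + 2) x) (Fil (m + 1) x)),
      IsSecondFundamentalForm F D (Fil (m - 1)) (Fil m) (Fil m) (Fil (m + 1)) x φ ∧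
      IsSecondFundamentalForm F D (Fil m) (Fil (m + 1)) (Fil (m + 1)) (Fil (m + 2)) x ψ ∧
      Function.Bijective fun e ↦ ψ ∘ₗ φ e

/-- Generalized `SO(2n, ℂ)`-quasiopers with underlying holomorphic vector bundle `E` and with
filtration of length `2m+1`. -/
structure GeneralizedQuasioper (n m : ℕ) where
  /-- The bilinear form `B₀`. -/
  B : Π x, E x →L[ℂ] E x →L[ℂ] ℂ
  /-- The filtration. -/
  Fil : ℕ → Π x, Submodule ℂ (E x)
  /-- The connection. -/
  D : CovariantDerivative 𝓘(ℂ) F E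
  isSOStructure : IsSOStructure F n B
  isFiltration : IsFiltration F B m Fil
  isFilteredConnection : IsFilteredConnection F B m Fil D

namespace GeneralizedQuasioper

variable {F E} {n m : ℕ}

/-- The subbundle `𝔽 = D̂^{2m}(F₁)` of `E`. -/
def bundleF (Q : GeneralizedQuasioper F E n m) : Π x, Submodule ℂ (E x) :=
  iterSaturation F Q.D (2 * m) (Q.Fil 1)

/-- The connection `D*` on `E*`. -/
def dualD (Q : GeneralizedQuasioper F E n m) :
    CovariantDerivative 𝓘(ℂ) (F →L[ℂ] ℂ) (DualBundle E) :=
  dualConnection Q.D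

/-- The filtration of the dual quasioper: `G_j` is the kernel of the restriction map
`E* → (F_{2m+1-j})*`. -/
def dualFil (Q : GeneralizedQuasioper F E n m) (j : ℕ) (x : X) : Submodule ℂ (DualBundle E x) :=
  LinearMap.ker ((Q.Fil (2 * m + 1 - j) x).subtype.dualMap ∘ₗ
    (ContinuousLinearMap.coeLM ℂ : (E x →L[ℂ] ℂ) →ₗ[ℂ] E x →ₗ[ℂ] ℂ))

/-- The subbundle `𝔾 = (D̂*)^{2m}(G₁)` of `E*`. -/
def bundleG (Q : GeneralizedQuasioper F E n m) : Π x, Submodule ℂ (DualBundle E x) :=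
  iterSaturation (F →L[ℂ] ℂ) Q.dualD (2 * m) (Q.dualFil 1)

/-- The subbundle `𝒮 = (E* / 𝔾)*` of `E** = E`: the vectors of `E` whose evaluation on `E*` lies in
the image of the dual `(E* / 𝔾)* → E**` of the quotient map `E* → E* / 𝔾`. -/
def bundleS (Q : GeneralizedQuasioper F E n m) (x : X) : Submodule ℂ (E x) :=
  Submodule.comap
    (ContinuousLinearMap.coeLM ℂ : (E x →L[ℂ] ℂ) →ₗ[ℂ] E x →ₗ[ℂ] ℂ).flip
    (LinearMap.range (Q.bundleG x).mkQ.dualMap)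

end GeneralizedQuasioper

end Quasioper

end SOQuasioper

end

/-!
Near a point, differentiate a frame `e 0 i` of `F₁` repeatedly along a nowhere vanishing vector
field: this gives sections `e j i` of `F_{j+1}`. As long as they are linearly independent, those
with `j ≤ k` span the `k`-th iterated saturation of `F₁`, which is therefore a subbundle.

To see that they are independent for `j ≤ 2m`, consider their Gram matrix for `B`. It is block
anti-triangular because `F_{j+1} ⟂ F_{2m-j}`, and as `B` is parallel its antidiagonal blocks are
`± B(e 0 i, e (2m) l)`. The isomorphism conditions on the second fundamental forms make the
`e (2m) l` generate `E / F_{2m}`, which `B` pairs perfectly with `F₁ = F_{2m}^⊥`. So the Gram matrix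
is invertible, which gives independence and also that `B` is nondegenerate on `𝔽`, i.e.
`E = 𝔽 ⊕ 𝔽^⊥`. Finally `a ↦ B(a, ·)` identifies `(E, D, F₁)` with `(E*, D*, G₁)`; hence it maps `𝔽`
onto `𝔾`, and `𝒮`, the annihilator of `𝔾`, is `𝔽^⊥`.
-/

noncomputable section

namespace SOQuasioper

section LinearAlgebra

variable {K A : Type*} [Field K] [AddCommGroup A] [Module K A]

theorem det_ne_zero_of_antitriangular {R ρ : Type*} [CommRing R] [IsDomain R] [Fintype ρ]
    [DecidableEq ρ] {N : ℕ} {M : Matrix (Fin N × ρ) (Fin N × ρ) R}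
    (hM : ∀ p q, q.1 < p.1.rev → M p q = 0)
    (hdet : ∀ j, (Matrix.of fun i l ↦ M (j, i) (j.rev, l)).det ≠ 0) : M.det ≠ 0 := by
  let σ : Equiv.Perm (Fin N × ρ) := Fin.revPerm.prodCongr (Equiv.refl ρ)
  have htri : (M.submatrix σ id).BlockTriangular Prod.fst := fun p q hqp ↦ hM _ _ (by simpa [σ])
  have hblock (k : Fin N) : ((M.submatrix σ id).toSquareBlock Prod.fst k).det ≠ 0 := by
    let ε : {p : Fin N × ρ // p.1 = k} ≃ ρ :=
      { toFun p := p.1.2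
        invFun i := ⟨(k, i), rfl⟩
        left_inv := by rintro ⟨⟨_, i⟩, rfl⟩; rfl
        right_inv _ := rfl }
    have hk := hdet k.rev
    rw [Fin.rev_rev] at hk
    rwa [← Matrix.det_submatrix_equiv_self ε.symm]
  intro h
  have hzero : (M.submatrix σ id).det = 0 := by rw [Matrix.det_permute, h, mul_zero]
  rw [htri.det_fintype] at hzero
  exact Finset.prod_ne_zero_iff.2 (fun k _ ↦ hblock k) hzero

theorem mem_orthogonal_span_range_iff {ι : Type*} {b : LinearMap.BilinForm K A} {g : ι → A}
    {a : A} : a ∈ b.orthogonal (Submodule.span K (Set.range g)) ↔ ∀ i, b (g i) a = 0 := by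
  rw [LinearMap.BilinForm.mem_orthogonal_iff]
  change Submodule.span K (Set.range g) ≤ LinearMap.ker (b.flip a) ↔ _
  rw [Submodule.span_le, Set.range_subset_iff]
  rfl

theorem det_gram_ne_zero_iff {ι : Type*} [Fintype ι] [DecidableEq ι]
    (b : LinearMap.BilinForm K A) (g : ι → A) :
    (Matrix.of fun i j ↦ b (g i) (g j)).det ≠ 0 ↔ LinearIndependent K g ∧
      Disjoint (Submodule.span K (Set.range g))
        (b.orthogonal (Submodule.span K (Set.range g))) := by
  have horth (c : ι → K) : (Matrix.of fun i j ↦ b (g i) (g j)).mulVec c = 0 ↔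
      ∑ j, c j • g j ∈ b.orthogonal (Submodule.span K (Set.range g)) := by
    rw [mem_orthogonal_span_range_iff, funext_iff]
    simp [Matrix.mulVec, dotProduct, mul_comm]
  rw [Ne, ← Matrix.exists_mulVec_eq_zero_iff, Fintype.linearIndependent_iff,
    Submodule.disjoint_def]
  refine ⟨fun h ↦ ⟨fun c hc ↦ ?_, fun a ha ha' ↦ ?_⟩, ?_⟩
  · by_contra! hne
    exact h ⟨c, fun h0 ↦ hne.elim fun i hi ↦ hi (congrFun h0 i), (horth c).2 (hc ▸ zero_mem _)⟩
  · obtain ⟨c, rfl⟩ := (Submodule.mem_span_range_iff_exists_fun K).1 ha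
    by_contra hne
    exact h ⟨c, fun h0 ↦ hne (by simp [h0]), (horth c).2 ha'⟩
  · rintro ⟨hli, hdisj⟩ ⟨c, hne, hc⟩
    have hmem : ∑ j, c j • g j ∈ Submodule.span K (Set.range g) :=
      (Submodule.mem_span_range_iff_exists_fun K).2 ⟨c, rfl⟩
    exact hne (funext (hli c (hdisj _ hmem ((horth c).1 hc))))

theorem linearIndependent_of_det_ne_zero {ι : Type*} [Fintype ι] [DecidableEq ι]
    (φ : ι → A →ₗ[K] K) {g : ι → A} (h : (Matrix.of fun i j ↦ φ i (g j)).det ≠ 0) :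
    LinearIndependent K g := by
  refine LinearIndependent.of_comp (LinearMap.pi φ) ?_
  exact Matrix.linearIndependent_cols_iff_isUnit.2 ((Matrix.isUnit_iff_isUnit_det _).2 h.isUnit)

theorem exists_dual_family {ι : Type*} [Finite ι] [DecidableEq ι] {g : ι → A}
    (hg : LinearIndependent K g) :
    ∃ φ : ι → A →ₗ[K] K, Matrix.of (fun i j ↦ φ i (g j)) = 1 := by
  cases nonempty_fintype ι
  obtain ⟨L, hL⟩ := (Fintype.linearCombination K g).exists_leftInverse_of_injective
    (LinearMap.ker_eq_bot.2 hg.fintypeLinearCombination_injective)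
  refine ⟨fun i ↦ LinearMap.proj i ∘ₗ L, ?_⟩
  ext i j
  have h := LinearMap.congr_fun hL (Pi.single j 1)
  simp only [LinearMap.comp_apply, Fintype.linearCombination_apply_single, one_smul,
    LinearMap.id_apply] at h
  simp [h, Pi.single_apply, Matrix.one_apply]

theorem le_sup_span_of_span_quotient_eq_top {ι : Type*} {V W : Submodule K A} {g : ι → V}
    (h : Submodule.span K (Set.range fun i ↦ (W.submoduleOf V).mkQ (g i)) = ⊤) :
    V ≤ W ⊔ Submodule.span K (Set.range fun i ↦ (g i : A)) := by
  have hmap : (Submodule.span K (Set.range g)).map (W.submoduleOf V).mkQ = ⊤ := by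
    rw [Submodule.map_span, ← Set.range_comp]
    exact h
  rw [Submodule.map_mkQ_eq_top] at hmap
  calc V = (W.submoduleOf V ⊔ Submodule.span K (Set.range g)).map V.subtype := by
        rw [hmap, Submodule.map_subtype_top]
    _ = (W.submoduleOf V).map V.subtype ⊔ Submodule.span K (Set.range fun i ↦ (g i : A)) := by
        rw [Submodule.map_sup, Submodule.map_span, ← Set.range_comp]
        rfl
    _ ≤ _ := sup_le_sup_right (Submodule.map_comap_le _ _) _

end LinearAlgebra

section Cramer

variable {𝕜 : Type*} [NontriviallyNormedField 𝕜] {V : Type*} [NormedAddCommGroup V]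
  [NormedSpace 𝕜 V] {H : Type*} [TopologicalSpace H] {I : ModelWithCorners 𝕜 V H}
  {M : Type*} [TopologicalSpace M] [ChartedSpace H M] {n : ℕ∞ω} {x₀ : M}
  {ι : Type*} [Fintype ι] [DecidableEq ι] {A : M → Matrix ι ι 𝕜}

theorem contMDiffAt_det (hA : ∀ i j, CMDiffAt n (fun x ↦ A x i j) x₀) :
    CMDiffAt n (fun x ↦ (A x).det) x₀ := by
  simp only [Matrix.det_apply']
  exact contMDiffAt_finsetSum fun σ _ ↦
    contMDiffAt_const.mul (contMDiffAt_finsetProd fun i _ ↦ hA _ _)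

theorem contMDiffAt_of_mulVec_eq [CompleteSpace 𝕜] {b c : M → ι → 𝕜}
    (hA : ∀ i j, CMDiffAt n (fun x ↦ A x i j) x₀) (hb : ∀ i, CMDiffAt n (fun x ↦ b x i) x₀)
    (hdet : (A x₀).det ≠ 0) (h : ∀ᶠ x in 𝓝 x₀, (A x).mulVec (c x) = b x) (i : ι) :
    CMDiffAt n (fun x ↦ c x i) x₀ := by
  have hd := contMDiffAt_det hA
  have hcramer : CMDiffAt n (fun x ↦ (A x).cramer (b x) i) x₀ := by
    simp only [Matrix.cramer_apply]
    refine contMDiffAt_det fun k j ↦ ?_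
    obtain rfl | hj := eq_or_ne j i
    · simpa only [Matrix.updateCol_self] using hb k
    · simpa only [Matrix.updateCol_ne hj] using hA k j
  refine ((hd.inv₀ hdet).mul hcramer).congr_of_eventuallyEq ?_
  filter_upwards [h, hd.continuousAt.eventually_ne hdet] with x hx hx'
  have hcx : (A x).cramer (b x) = (A x).det • c x := by
    rw [Matrix.cramer_eq_adjugate_mulVec, ← hx, Matrix.mulVec_mulVec, Matrix.adjugate_mul,
      Matrix.smul_mulVec, Matrix.one_mulVec]
  simp only [Pi.mul_apply, hcx, Pi.smul_apply, smul_eq_mul]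
  field_simp

end Cramer

section Sections

variable {X : Type*} [TopologicalSpace X] [ChartedSpace ℂ X]
  {F : Type*} [NormedAddCommGroup F] [NormedSpace ℂ F]
  {E : X → Type*} [TopologicalSpace (TotalSpace F E)]
  [∀ x, TopologicalSpace (E x)] [FiberBundle F E] {ι : Type*}

variable (F) in
/-- The section `s` of `E` is holomorphic near `x`. -/
abbrev IsHolSectionAt (s : Π x, E x) (x : X) : Prop :=
  CMDiffAt ω (fun y ↦ TotalSpace.mk' F y (s y)) x

theorem IsHolSection.mono {U V : Set X} {s : Π x, E x} (hs : IsHolSection F U s) (h : V ⊆ U) :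
    IsHolSection F V s :=
  ContMDiffOn.mono hs h

theorem IsHolSection.isHolSectionAt {U : Set X} {s : Π x, E x} (hs : IsHolSection F U s)
    (hU : IsOpen U) {x : X} (hx : x ∈ U) : IsHolSectionAt F s x :=
  ContMDiffOn.contMDiffAt hs (hU.mem_nhds hx)

theorem IsHolSectionAt.mdifferentiableAt {s : Π x, E x} {x : X} (hs : IsHolSectionAt F s x) :
    MDiffAt (T% s) x :=
  ContMDiffAt.mdifferentiableAt hs (by simp)

variable [∀ x, AddCommGroup (E x)] [∀ x, Module ℂ (E x)] [VectorBundle ℂ F E]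

omit [ChartedSpace ℂ X] in
theorem finrank_fiber (x : X) : Module.finrank ℂ (E x) = Module.finrank ℂ F :=
  ((trivializationAt F E x).linearEquivAt ℂ x
    (FiberBundle.mem_baseSet_trivializationAt' x)).finrank_eq

omit [ChartedSpace ℂ X] in
variable (F) in
theorem finiteDimensional_fiber [FiniteDimensional ℂ F] (x : X) : FiniteDimensional ℂ (E x) :=
  ((trivializationAt F E x).linearEquivAt ℂ x
    (FiberBundle.mem_baseSet_trivializationAt' x)).symm.finiteDimensional

theorem exists_isHolSection_eq [ContMDiffVectorBundle ω F E 𝓘(ℂ)] {x₀ : X} (a : E x₀) :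
    ∃ (U : Set X) (s : Π x, E x), IsOpen U ∧ x₀ ∈ U ∧ IsHolSection F U s ∧ s x₀ = a := by
  obtain ⟨N, hN, hs⟩ := FiberBundle.exists_contMDiffOn_extend (k := ω) 𝓘(ℂ) F a
  obtain ⟨U, hUN, hU, hx₀⟩ := mem_nhds_iff.1 hN
  exact ⟨U, FiberBundle.extend F a, hU, hx₀, hs.mono hUN, FiberBundle.extend_apply_self F a⟩

theorem contMDiffAt_pairing {φ : Π x, DualBundle E x} {s : Π x, E x} {x : X}
    (hφ : IsHolSectionAt (F →L[ℂ] ℂ) φ x) (hs : IsHolSectionAt F s x) :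
    CMDiffAt ω (pairing φ s) x := by
  have h := ContMDiffAt.clm_bundle_apply (F₁ := F) (F₂ := ℂ) (E₂ := Bundle.Trivial X ℂ)
    (b := fun y : X ↦ y) (ϕ := φ) (v := s) hφ hs
  exact (contMDiffAt_totalSpace.1 h).2

theorem exists_dual_frame [FiniteDimensional ℂ F] [ContMDiffVectorBundle ω F E 𝓘(ℂ)]
    [Finite ι] [DecidableEq ι] {e : ι → Π x, E x} {x : X}
    (he : LinearIndependent ℂ fun i ↦ e i x) :
    ∃ φ : ι → Π y, DualBundle E y, (∀ i, IsHolSectionAt (F →L[ℂ] ℂ) (φ i) x) ∧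
      Matrix.of (fun i j ↦ pairing (φ i) (e j) x) = 1 := by
  let τ := (trivializationAt F E x).continuousLinearEquivAt ℂ x
    (FiberBundle.mem_baseSet_trivializationAt' x)
  obtain ⟨L, hL⟩ := exists_dual_family (he.map' (τ : E x →ₗ[ℂ] F) τ.toLinearEquiv.ker)
  refine ⟨fun i ↦ FiberBundle.extend (F →L[ℂ] ℂ) (E := DualBundle E)
    ((L i).toContinuousLinearMap ∘L (τ : E x →L[ℂ] F)), fun i ↦
    FiberBundle.contMDiffAt_extend 𝓘(ℂ) (F →L[ℂ] ℂ) _, ?_⟩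
  simp only [pairing, FiberBundle.extend_apply_self]
  exact hL

theorem exists_coeff_of_pairing [Fintype ι] [DecidableEq ι] {φ : ι → Π x, DualBundle E x}
    {e : ι → Π x, E x} {s a : Π x, E x} {x : X}
    (hφ : ∀ i, IsHolSectionAt (F →L[ℂ] ℂ) (φ i) x) (he : ∀ i, IsHolSectionAt F (e i) x)
    (hs : IsHolSectionAt F s x) (hdet : (Matrix.of fun i j ↦ pairing (φ i) (e j) x).det ≠ 0)
    (ha : ∀ᶠ y in 𝓝 x, a y ∈ Submodule.span ℂ (Set.range fun i ↦ e i y))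
    (has : ∀ᶠ y in 𝓝 x, ∀ i, φ i y (a y) = φ i y (s y)) :
    ∃ c : ι → X → ℂ, (∀ i, CMDiffAt ω (c i) x) ∧ ∀ᶠ y in 𝓝 x, ∑ i, c i y • e i y = a y := by
  have hex (y : X) : ∃ c : ι → ℂ, a y ∈ Submodule.span ℂ (Set.range fun i ↦ e i y) →
      ∑ i, c i • e i y = a y := by
    by_cases hy : a y ∈ Submodule.span ℂ (Set.range fun i ↦ e i y)
    · exact ((Submodule.mem_span_range_iff_exists_fun ℂ).1 hy).imp fun _ h _ ↦ h
    · exact ⟨0, fun h ↦ absurd h hy⟩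
  choose c hc using hex
  refine ⟨fun i y ↦ c y i, contMDiffAt_of_mulVec_eq
    (A := fun y ↦ Matrix.of fun i j ↦ pairing (φ i) (e j) y) (b := fun y i ↦ pairing (φ i) s y)
    (fun i j ↦ contMDiffAt_pairing (hφ i) (he j)) (fun i ↦ contMDiffAt_pairing (hφ i) hs) hdet ?_,
    ha.mono hc⟩
  filter_upwards [ha, has] with y hy hys
  ext i
  rw [pairing, ← hys i, ← hc y hy, map_sum]
  simp [Matrix.mulVec, dotProduct, pairing, mul_comm]

variable [FiniteDimensional ℂ F] [ContMDiffVectorBundle ω F E 𝓘(ℂ)]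

theorem exists_coeff_of_linearIndependent [Fintype ι] {e : ι → Π x, E x} {s : Π x, E x} {x : X}
    (he : ∀ i, IsHolSectionAt F (e i) x) (hli : LinearIndependent ℂ fun i ↦ e i x)
    (hs : IsHolSectionAt F s x)
    (hse : ∀ᶠ y in 𝓝 x, s y ∈ Submodule.span ℂ (Set.range fun i ↦ e i y)) :
    ∃ c : ι → X → ℂ, (∀ i, CMDiffAt ω (c i) x) ∧ ∀ᶠ y in 𝓝 x, ∑ i, c i y • e i y = s y := by
  classical
  obtain ⟨φ, hφ, hφe⟩ := exists_dual_frame (F := F) hli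
  exact exists_coeff_of_pairing hφ he hs (by simp [hφe]) hse (.of_forall fun _ _ ↦ rfl)

theorem eventually_linearIndependent [Finite ι] {e : ι → Π x, E x} {x : X}
    (he : ∀ i, IsHolSectionAt F (e i) x) (hli : LinearIndependent ℂ fun i ↦ e i x) :
    ∀ᶠ y in 𝓝 x, LinearIndependent ℂ fun i ↦ e i y := by
  classical
  cases nonempty_fintype ι
  obtain ⟨φ, hφ, hφe⟩ := exists_dual_frame (F := F) hli
  have hdet : CMDiffAt ω (fun y ↦ (Matrix.of fun i j ↦ pairing (φ i) (e j) y).det) x :=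
    contMDiffAt_det fun i j ↦ contMDiffAt_pairing (hφ i) (he j)
  filter_upwards [hdet.continuousAt.eventually_ne (y := 0) (by simp [hφe])] with y hy
  exact linearIndependent_of_det_ne_zero (fun i ↦ (φ i y : E y →ₗ[ℂ] ℂ)) hy

variable [∀ x, IsTopologicalAddGroup (E x)] [∀ x, ContinuousSMul ℂ (E x)]

omit [FiniteDimensional ℂ F] [ContMDiffVectorBundle ω F E 𝓘(ℂ)] in
theorem covariantDerivative_sum_smul (D : CovariantDerivative 𝓘(ℂ) F E) (A : Finset ι)
    {e : ι → Π x, E x} {c : ι → X → ℂ} {x : X} (he : ∀ i, MDiffAt (T% (e i)) x)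
    (hc : ∀ i, MDiffAt (c i) x) (v : TangentSpace 𝓘(ℂ) x) :
    D (fun y ↦ ∑ i ∈ A, c i y • e i y) x v =
      ∑ i ∈ A, (mvfderiv 𝓘(ℂ) (c i) x v • e i x + c i x • D (e i) x v) := by
  classical
  have hce (i : ι) : MDiffAt (T% (c i • e i)) x := (hc i).smul_section (he i)
  induction A using Finset.induction_on with
  | empty =>
    simp only [Finset.sum_empty]
    exact DFunLike.congr_fun (congrFun D.zero x) v
  | insert i A hi ih =>
    have hA : MDiffAt (T% fun y ↦ ∑ i ∈ A, c i y • e i y) x :=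
      MDifferentiableAt.sum_section fun i _ ↦ hce i
    simp only [Finset.sum_insert hi]
    change D (c i • e i + fun y ↦ ∑ i ∈ A, c i y • e i y) x v = _
    rw [D.isCovariantDerivativeOnUniv.add (hce i) hA, add_apply, ih,
      D.isCovariantDerivativeOnUniv.leibniz (he i) (hc i)]
    simp [add_comm]

theorem covariantDerivative_mem_span_sup_span (D : CovariantDerivative 𝓘(ℂ) F E) [Finite ι]
    {e : ι → Π x, E x} {s : Π x, E x} {x : X} (he : ∀ i, IsHolSectionAt F (e i) x)
    (hli : LinearIndependent ℂ fun i ↦ e i x) (hs : IsHolSectionAt F s x)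
    (hse : ∀ᶠ y in 𝓝 x, s y ∈ Submodule.span ℂ (Set.range fun i ↦ e i y))
    (v : TangentSpace 𝓘(ℂ) x) :
    D s x v ∈ Submodule.span ℂ (Set.range fun i ↦ e i x) ⊔
      Submodule.span ℂ (Set.range fun i ↦ D (e i) x v) := by
  cases nonempty_fintype ι
  obtain ⟨c, hc, hcs⟩ := exists_coeff_of_linearIndependent he hli hs hse
  have hsum : IsHolSectionAt F (fun y ↦ ∑ i, c i y • e i y) x :=
    ContMDiffAt.sum_section fun i _ ↦ (hc i).smul_section (he i)
  rw [D.isCovariantDerivativeOnUniv.congr_of_eventuallyEq hs.mdifferentiableAt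
    hsum.mdifferentiableAt Filter.univ_mem (hcs.mono fun _ h ↦ h.symm),
    covariantDerivative_sum_smul D _ (fun i ↦ (he i).mdifferentiableAt)
      (fun i ↦ (hc i).mdifferentiableAt (by simp)), Finset.sum_add_distrib]
  exact Submodule.add_mem_sup
    (Submodule.sum_mem _ fun i _ ↦ Submodule.smul_mem _ _ (Submodule.subset_span ⟨i, rfl⟩))
    (Submodule.sum_mem _ fun i _ ↦ Submodule.smul_mem _ _ (Submodule.subset_span ⟨i, rfl⟩))

end Sections

section Complement

variable {X : Type*} [TopologicalSpace X] [ChartedSpace ℂ X]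
  {F : Type*} [NormedAddCommGroup F] [NormedSpace ℂ F]
  {E : X → Type*} [TopologicalSpace (TotalSpace F E)]
  [∀ x, AddCommGroup (E x)] [∀ x, Module ℂ (E x)] [∀ x, TopologicalSpace (E x)]
  [FiberBundle F E] {V P S : Π x, Submodule ℂ (E x)}

theorem IsHolSubbundle.eventually_finrank_eq (hV : IsHolSubbundle F V) (x₀ : X) :
    ∀ᶠ x in 𝓝 x₀, Module.finrank ℂ (V x) = Module.finrank ℂ (V x₀) := by
  obtain ⟨U, hU, hx₀, k, e, -, he⟩ := hV x₀
  have hrank (x) (hx : x ∈ U) : Module.finrank ℂ (V x) = k := by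
    rw [← (he x hx).2, finrank_span_eq_card (he x hx).1, Fintype.card_fin]
  filter_upwards [hU.mem_nhds hx₀] with x hx
  rw [hrank x hx, hrank x₀ hx₀]

variable [VectorBundle ℂ F E] [FiniteDimensional ℂ F] [ContMDiffVectorBundle ω F E 𝓘(ℂ)]

theorem isHolSubbundle_of_finrank_eq
    (hrank : ∀ x₀, ∀ᶠ x in 𝓝 x₀, Module.finrank ℂ (V x) = Module.finrank ℂ (V x₀))
    (hV : ∀ x₀, ∀ a ∈ V x₀, ∃ (U : Set X) (s : Π x, E x), IsOpen U ∧ x₀ ∈ U ∧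
      IsHolSection F U s ∧ (∀ x ∈ U, s x ∈ V x) ∧ s x₀ = a) : IsHolSubbundle F V := by
  intro x₀
  have hfd (x : X) := finiteDimensional_fiber (E := E) F x
  let v := Module.finBasis ℂ (V x₀)
  choose U s hU hx₀ hs hsV hsv using fun i ↦ hV x₀ (v i) (v i).2
  have hli : LinearIndependent ℂ fun i ↦ s i x₀ := by
    simp only [hsv]
    exact v.linearIndependent.map' (V x₀).subtype (Submodule.ker_subtype _)
  obtain ⟨W, hW, hWo, hxW⟩ := eventually_nhds_iff.1 <| (hrank x₀).and <|
    eventually_linearIndependent (fun i ↦ (hs i).isHolSectionAt (hU i) (hx₀ i)) hli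
  refine ⟨W ∩ ⋂ i, U i, hWo.inter (isOpen_iInter_of_finite hU),
    ⟨hxW, Set.mem_iInter.2 hx₀⟩, _, s,
    fun i ↦ (hs i).mono fun x hx ↦ Set.mem_iInter.1 hx.2 i, fun x hx ↦ ⟨(hW x hx.1).2, ?_⟩⟩
  refine Submodule.eq_of_le_of_finrank_eq (Submodule.span_le.2 ?_) ?_
  · rintro _ ⟨i, rfl⟩
    exact hsV i x (Set.mem_iInter.1 hx.2 i)
  · rw [finrank_span_eq_card (hW x hx.1).2, Fintype.card_fin, (hW x hx.1).1]

theorem isHolDirectSum_of_isHolSection_projection (hP : IsHolSubbundle F P)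
    (hPS : ∀ x, IsCompl (P x) (S x))
    (hproj : ∀ (U : Set X) (s : Π x, E x), IsOpen U → IsHolSection F U s →
      IsHolSection F U fun x ↦ (P x).projection (S x) (hPS x) (s x)) : IsHolDirectSum F P S where
  subbundle_left := hP
  bijective x := (Submodule.prodEquivOfIsCompl _ _ (hPS x)).bijective
  sections U s hU hs :=
    ⟨_, fun x ↦ s x - (P x).projection (S x) (hPS x) (s x), hproj U s hU hs,
      ContMDiffOn.sub_section hs (hproj U s hU hs), fun x _ ↦
      ⟨Submodule.projection_apply_mem _ _, Submodule.sub_projection_mem _ _,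
        add_sub_cancel _ _⟩⟩
  subbundle_right := by
    have hfd (x : X) := finiteDimensional_fiber (E := E) F x
    refine isHolSubbundle_of_finrank_eq (fun x₀ ↦ ?_) fun x₀ a ha ↦ ?_
    · have hrank (x : X) : Module.finrank ℂ (P x) + Module.finrank ℂ (S x) =
          Module.finrank ℂ F := by
        rw [Submodule.finrank_add_eq_of_isCompl (hPS x), finrank_fiber (F := F)]
      filter_upwards [hP.eventually_finrank_eq x₀] with x hx
      have := hrank x
      have := hrank x₀
      omega
    · obtain ⟨U, s, hU, hx₀, hs, rfl⟩ := exists_isHolSection_eq (F := F) a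
      refine ⟨U, fun x ↦ s x - (P x).projection (S x) (hPS x) (s x), hU, hx₀,
        ContMDiffOn.sub_section hs (hproj U s hU hs),
        fun x _ ↦ Submodule.sub_projection_mem _ _, ?_⟩
      exact sub_eq_self.2 ((Submodule.projection_apply_eq_zero_iff (hPS x₀)).2 ha)

end Complement

section BilinearForm

variable {X : Type*} [TopologicalSpace X] [ChartedSpace ℂ X]
  {F : Type*} [NormedAddCommGroup F] [NormedSpace ℂ F]
  {E : X → Type*} [TopologicalSpace (TotalSpace F E)]
  [∀ x, AddCommGroup (E x)] [∀ x, Module ℂ (E x)] [∀ x, TopologicalSpace (E x)]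
  [FiberBundle F E] [VectorBundle ℂ F E]

variable (F) in
/-- The family `B` of bilinear forms on the fibres of `E` is holomorphic. -/
abbrev IsHolBilinForm (B : Π x, E x →L[ℂ] E x →L[ℂ] ℂ) : Prop :=
  ContMDiff 𝓘(ℂ) (𝓘(ℂ).prod 𝓘(ℂ, F →L[ℂ] F →L[ℂ] ℂ)) ω
    (fun x ↦ TotalSpace.mk' (F →L[ℂ] F →L[ℂ] ℂ)
      (E := fun x ↦ E x →L[ℂ] E x →L[ℂ] Bundle.Trivial X ℂ x) x (B x))

/-- The section `B(s, ·)` of `E*`. -/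
def flat (B : Π x, E x →L[ℂ] E x →L[ℂ] ℂ) (s : Π x, E x) : Π x, DualBundle E x :=
  fun x ↦ B x (s x)

theorem IsHolBilinForm.isHolSection_flat {B : Π x, E x →L[ℂ] E x →L[ℂ] ℂ}
    (hB : IsHolBilinForm F B) {U : Set X} {s : Π x, E x} (hs : IsHolSection F U s) :
    IsHolSection (F →L[ℂ] ℂ) U (flat B s) :=
  ContMDiffOn.clm_bundle_apply (F₁ := F) (F₂ := F →L[ℂ] ℂ)
    (E₂ := fun x ↦ E x →L[ℂ] Bundle.Trivial X ℂ x) hB.contMDiffOn hs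

theorem IsHolSubbundle.isHolDirectSum_orthogonal [FiniteDimensional ℂ F]
    [ContMDiffVectorBundle ω F E 𝓘(ℂ)] {P : Π x, Submodule ℂ (E x)}
    (hP : IsHolSubbundle F P) {B : Π x, E x →L[ℂ] E x →L[ℂ] ℂ} (hB : IsHolBilinForm F B)
    (hrefl : ∀ x, (B x).toBilinForm.IsRefl)
    (hdisj : ∀ x, Disjoint (P x) ((B x).toBilinForm.orthogonal (P x))) :
    IsHolDirectSum F P fun x ↦ (B x).toBilinForm.orthogonal (P x) := by
  have hfd (x : X) := finiteDimensional_fiber (E := E) F x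
  have hcompl (x : X) := (LinearMap.BilinForm.isCompl_orthogonal_iff_disjoint (hrefl x)).2 (hdisj x)
  refine isHolDirectSum_of_isHolSection_projection hP hcompl fun U s hU hs x hx ↦ ?_
  obtain ⟨W, hW, hxW, k, e, he, hPe⟩ := hP x
  have hgram := (det_gram_ne_zero_iff (B x).toBilinForm fun i ↦ e i x).2
    ⟨(hPe x hxW).1, (hPe x hxW).2 ▸ hdisj x⟩
  obtain ⟨c, hc, hcs⟩ := exists_coeff_of_pairing
    (a := fun y ↦ (P y).projection _ (hcompl y) (s y))
    (fun i ↦ (hB.isHolSection_flat (he i)).isHolSectionAt hW hxW)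
    (fun i ↦ (he i).isHolSectionAt hW hxW) (hs.isHolSectionAt hU hx) hgram
    (by
      filter_upwards [hW.mem_nhds hxW] with y hy
      rw [(hPe y hy).2]
      exact Submodule.projection_apply_mem _ _)
    (by
      filter_upwards [hW.mem_nhds hxW] with y hy i
      have hi : e i y ∈ P y := (hPe y hy).2 ▸ Submodule.subset_span ⟨i, rfl⟩
      have horth := LinearMap.BilinForm.mem_orthogonal_iff.1
        (Submodule.sub_projection_mem (hcompl y) (s y)) _ hi
      rw [ContinuousLinearMap.toBilinForm_apply, map_sub, sub_eq_zero] at horth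
      exact horth.symm)
  have hsum : IsHolSectionAt F (fun y ↦ ∑ i, c i y • e i y) x :=
    ContMDiffAt.sum_section fun i _ ↦ (hc i).smul_section ((he i).isHolSectionAt hW hxW)
  exact (hsum.congr_of_eventuallyEq (hcs.mono fun y hy ↦ by simp only [hy])).contMDiffWithinAt

end BilinearForm

section FrameSpan

variable {X : Type*} {E : X → Type*} [∀ x, AddCommGroup (E x)] [∀ x, Module ℂ (E x)]
  {ρ : Type*} {e : ℕ → ρ → Π x, E x} {k : ℕ} {x : X}

/-- The span at `x` of the sections `e j i` with `j ≤ k`. -/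
def frameSpan (e : ℕ → ρ → Π x, E x) (k : ℕ) (x : X) : Submodule ℂ (E x) :=
  Submodule.span ℂ (Set.range fun p : Fin (k + 1) × ρ ↦ e p.1 p.2 x)

theorem mem_frameSpan {j : ℕ} (hj : j ≤ k) (i : ρ) : e j i x ∈ frameSpan e k x :=
  Submodule.subset_span ⟨(⟨j, Nat.lt_succ_of_le hj⟩, i), rfl⟩

theorem frameSpan_le_iff {W : Submodule ℂ (E x)} :
    frameSpan e k x ≤ W ↔ ∀ j ≤ k, ∀ i, e j i x ∈ W := by
  rw [frameSpan, Submodule.span_le, Set.range_subset_iff, Prod.forall, Fin.forall_iff]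
  simp only [Nat.lt_succ_iff, SetLike.mem_coe]

theorem frameSpan_zero : frameSpan e 0 x = Submodule.span ℂ (Set.range fun i ↦ e 0 i x) :=
  le_antisymm
    (frameSpan_le_iff.2 fun _ hj i ↦ by
      obtain rfl := Nat.le_zero.1 hj
      exact Submodule.subset_span ⟨i, rfl⟩)
    (Submodule.span_le.2 (Set.range_subset_iff.2 fun i ↦ mem_frameSpan le_rfl i))

theorem frameSpan_mono {l : ℕ} (h : k ≤ l) : frameSpan e k x ≤ frameSpan e l x :=
  frameSpan_le_iff.2 fun _ hj i ↦ mem_frameSpan (hj.trans h) i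

theorem linearIndependent_frame_mono {l : ℕ} (h : k ≤ l)
    (hl : LinearIndependent ℂ fun p : Fin (l + 1) × ρ ↦ e p.1 p.2 x) :
    LinearIndependent ℂ fun p : Fin (k + 1) × ρ ↦ e p.1 p.2 x :=
  hl.comp (Prod.map (Fin.castLE (Nat.succ_le_succ h)) id)
    ((Fin.castLE_injective _).prodMap Function.injective_id)

end FrameSpan

section Saturation

variable {X : Type*} [TopologicalSpace X] [ChartedSpace ℂ X]
  {F : Type*} [NormedAddCommGroup F] [NormedSpace ℂ F]
  {E : X → Type*} [TopologicalSpace (TotalSpace F E)]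
  [∀ x, AddCommGroup (E x)] [∀ x, Module ℂ (E x)] [∀ x, TopologicalSpace (E x)]
  [∀ x, IsTopologicalAddGroup (E x)] [∀ x, ContinuousSMul ℂ (E x)]
  [FiberBundle F E] {D : CovariantDerivative 𝓘(ℂ) F E} {V : Π x, Submodule ℂ (E x)}

/-- The family of subspaces generated by `V` and the derivatives of its holomorphic sections. It is
the minimal `D`-saturation of `V` as soon as it is a subbundle. -/
def derived (D : CovariantDerivative 𝓘(ℂ) F E) (V : Π x, Submodule ℂ (E x)) (x : X) :
    Submodule ℂ (E x) :=
  V x ⊔ Submodule.span ℂ {a | ∃ (U : Set X) (s : Π y, E y) (v : TangentSpace 𝓘(ℂ) x),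
    IsOpen U ∧ x ∈ U ∧ IsHolSection F U s ∧ (∀ y ∈ U, s y ∈ V y) ∧ D s x v = a}

theorem isLeast_derived (h : IsHolSubbundle F (derived D V)) :
    IsLeast (saturations F D V) (derived D V) := by
  refine ⟨⟨h, fun x ↦ le_sup_left, fun U s hU hs hsV x hx v ↦ ?_⟩, fun W hW x ↦ ?_⟩
  · exact Submodule.mem_sup_right
      (Submodule.subset_span ⟨U, s, v, hU, hx, hs, hsV, rfl⟩)
  · refine sup_le (hW.2.1 x) (Submodule.span_le.2 ?_)
    rintro _ ⟨U, s, v, hU, hx, hs, hsV, rfl⟩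
    exact hW.2.2 U s hU hs hsV x hx v

/-- A frame `e 0 i` of `V` over `U` together with its iterated derivatives `e j i` along the nowhere
vanishing vector field `w`. -/
structure IsDerivativeTower {ρ : Type*} (D : CovariantDerivative 𝓘(ℂ) F E)
    (V : Π x, Submodule ℂ (E x)) (U : Set X) (w : Π x : X, TangentSpace 𝓘(ℂ) x)
    (e : ℕ → ρ → Π x, E x) : Prop where
  isOpen : IsOpen U
  ne_zero : ∀ x ∈ U, w x ≠ 0
  isHolSection : ∀ j i, IsHolSection F U (e j i)
  deriv : ∀ j i, ∀ x ∈ U, e (j + 1) i x = D (e j i) x (w x)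
  linearIndependent : ∀ x ∈ U, LinearIndependent ℂ fun i ↦ e 0 i x
  span : ∀ x ∈ U, Submodule.span ℂ (Set.range fun i ↦ e 0 i x) = V x

/-- Every point has a neighbourhood with a derivative tower of `V` whose sections of order at most
`N` are linearly independent. -/
def HasIndependentTowers (D : CovariantDerivative 𝓘(ℂ) F E) (V : Π x, Submodule ℂ (E x))
    (N : ℕ) : Prop :=
  ∀ x₀ : X, ∃ (U : Set X) (w : Π x : X, TangentSpace 𝓘(ℂ) x) (r : ℕ) (e : ℕ → Fin r → Π x, E x),
    x₀ ∈ U ∧ IsDerivativeTower D V U w e ∧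
      ∀ x ∈ U, LinearIndependent ℂ fun p : Fin (N + 1) × Fin r ↦ e p.1 p.2 x

theorem exists_smul_eq_tangentVector {x : X} {w : TangentSpace 𝓘(ℂ) x} (hw : w ≠ 0)
    (v : TangentSpace 𝓘(ℂ) x) : ∃ c : ℂ, c • w = v :=
  exists_smul_eq_of_finrank_eq_one (V := ℂ) (Module.finrank_self ℂ) hw v

variable [VectorBundle ℂ F E] [FiniteDimensional ℂ F] [ContMDiffVectorBundle ω F E 𝓘(ℂ)]

section Tower

variable {ρ : Type*} [Finite ρ] {U : Set X} {w : Π x : X, TangentSpace 𝓘(ℂ) x}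
  {e : ℕ → ρ → Π x, E x} {k N : ℕ} {x : X}

theorem IsDerivativeTower.derived_eq_frameSpan_succ (h : IsDerivativeTower D V U w e)
    (hx : x ∈ U) (hli : LinearIndependent ℂ fun p : Fin (k + 1) × ρ ↦ e p.1 p.2 x)
    {W : Π x, Submodule ℂ (E x)} (hW : ∀ y ∈ U, W y = frameSpan e k y) :
    derived D W x = frameSpan e (k + 1) x := by
  have hWx : W x ≤ frameSpan e (k + 1) x := hW x hx ▸ frameSpan_mono k.le_succ
  refine le_antisymm (sup_le hWx (Submodule.span_le.2 ?_)) (frameSpan_le_iff.2 fun j hj i ↦ ?_)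
  · rintro _ ⟨U', s, v, hU', hx', hs, hsW, rfl⟩
    have hsE : ∀ᶠ y in 𝓝 x, s y ∈ frameSpan e k y := by
      filter_upwards [hU'.mem_nhds hx', h.isOpen.mem_nhds hx] with y hy' hy
      exact hW y hy ▸ hsW y hy'
    have hDe (p : Fin (k + 1) × ρ) : D (e p.1 p.2) x v ∈ frameSpan e (k + 1) x := by
      obtain ⟨c, rfl⟩ := exists_smul_eq_tangentVector (h.ne_zero x hx) v
      rw [map_smul, ← h.deriv p.1 p.2 x hx]
      exact Submodule.smul_mem _ c
        (mem_frameSpan (Nat.succ_le_succ (Nat.le_of_lt_succ p.1.2)) p.2)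
    have hDs := covariantDerivative_mem_span_sup_span D (e := fun p : Fin (k + 1) × ρ ↦ e p.1 p.2)
      (fun p ↦ (h.isHolSection p.1 p.2).isHolSectionAt h.isOpen hx) hli
      (hs.isHolSectionAt hU' hx') hsE v
    exact sup_le (frameSpan_mono k.le_succ)
      (Submodule.span_le.2 (Set.range_subset_iff.2 hDe)) hDs
  · obtain hj | rfl := hj.lt_or_eq
    · exact Submodule.mem_sup_left (hW x hx ▸ mem_frameSpan (Nat.le_of_lt_succ hj) i)
    · exact Submodule.mem_sup_right (Submodule.subset_span ⟨U, e k i, w x, h.isOpen, hx,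
        h.isHolSection k i, fun y hy ↦ hW y hy ▸ mem_frameSpan le_rfl i, (h.deriv k i x hx).symm⟩)

theorem IsDerivativeTower.iterate_derived_eq_frameSpan (h : IsDerivativeTower D V U w e)
    (hli : ∀ x ∈ U, LinearIndependent ℂ fun p : Fin (N + 1) × ρ ↦ e p.1 p.2 x) (hk : k ≤ N)
    (hx : x ∈ U) : (derived D)^[k] V x = frameSpan e k x := by
  induction k generalizing x with
  | zero => rw [Function.iterate_zero_apply, frameSpan_zero, h.span x hx]
  | succ k ih =>
    rw [Function.iterate_succ_apply']
    exact h.derived_eq_frameSpan_succ hx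
      (linearIndependent_frame_mono (Nat.le_of_succ_le hk) (hli x hx))
      fun y hy ↦ ih (Nat.le_of_succ_le hk) hy

end Tower

namespace HasIndependentTowers

variable {N k : ℕ}

theorem isHolSubbundle_iterate_derived (h : HasIndependentTowers D V N) (hk : k ≤ N) :
    IsHolSubbundle F ((derived D)^[k] V) := by
  intro x₀
  obtain ⟨U, w, r, e, hx₀, he, hli⟩ := h x₀
  let σ := (Fintype.equivFin (Fin (k + 1) × Fin r)).symm
  refine ⟨U, he.isOpen, hx₀, _, fun i ↦ e (σ i).1 (σ i).2, fun i ↦ he.isHolSection _ _,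
    fun x hx ↦ ⟨(linearIndependent_frame_mono hk (hli x hx)).comp σ σ.injective, ?_⟩⟩
  rw [he.iterate_derived_eq_frameSpan hli hk hx, frameSpan,
    ← σ.surjective.range_comp fun p ↦ e p.1 p.2 x]
  rfl

theorem iterSaturation_eq_iterate_derived (h : HasIndependentTowers D V N) (hk : k ≤ N) :
    iterSaturation F D k V = (derived D)^[k] V := by
  induction k with
  | zero => rfl
  | succ k ih =>
    have hsub := h.isHolSubbundle_iterate_derived hk
    rw [Function.iterate_succ_apply'] at hsub ⊢
    rw [← saturation_eq_of_isLeast F D _ _ (isLeast_derived hsub),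
      ← ih (Nat.le_of_succ_le hk)]
    exact Function.iterate_succ_apply' _ _ _

theorem isHolSubbundle_iterSaturation (h : HasIndependentTowers D V N) (hk : k ≤ N) :
    IsHolSubbundle F (iterSaturation F D k V) :=
  h.iterSaturation_eq_iterate_derived hk ▸ h.isHolSubbundle_iterate_derived hk

theorem isLeast_iterSaturation_succ (h : HasIndependentTowers D V N) (hk : k < N) :
    IsLeast (saturations F D (iterSaturation F D k V)) (iterSaturation F D (k + 1) V) := by
  have hsub := h.isHolSubbundle_iterate_derived (Nat.succ_le_of_lt hk)
  rw [h.iterSaturation_eq_iterate_derived hk.le,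
    h.iterSaturation_eq_iterate_derived (Nat.succ_le_of_lt hk)]
  rw [Function.iterate_succ_apply'] at hsub ⊢
  exact isLeast_derived hsub

theorem iterSaturation_eq_frameSpan (h : HasIndependentTowers D V N) (hk : k ≤ N) {ρ : Type*}
    [Finite ρ] {U : Set X} {w : Π x : X, TangentSpace 𝓘(ℂ) x} {e : ℕ → ρ → Π x, E x}
    (he : IsDerivativeTower D V U w e)
    (hli : ∀ x ∈ U, LinearIndependent ℂ fun p : Fin (N + 1) × ρ ↦ e p.1 p.2 x) {x : X}
    (hx : x ∈ U) : iterSaturation F D k V x = frameSpan e k x := by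
  rw [h.iterSaturation_eq_iterate_derived hk, he.iterate_derived_eq_frameSpan hli hk hx]

end HasIndependentTowers

end Saturation

section HolConnection

variable {X : Type*} [TopologicalSpace X] [ChartedSpace ℂ X] [IsManifold 𝓘(ℂ) ω X]
  {F : Type*} [NormedAddCommGroup F] [NormedSpace ℂ F]
  {E : X → Type*} [TopologicalSpace (TotalSpace F E)]
  [∀ x, AddCommGroup (E x)] [∀ x, Module ℂ (E x)] [∀ x, TopologicalSpace (E x)]
  [∀ x, IsTopologicalAddGroup (E x)] [∀ x, ContinuousSMul ℂ (E x)]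
  [FiberBundle F E] [VectorBundle ℂ F E]

theorem exists_vectorField (x₀ : X) :
    ∃ (U : Set X) (w : Π x : X, TangentSpace 𝓘(ℂ) x), IsOpen U ∧ x₀ ∈ U ∧
      IsHolSection (E := fun x : X ↦ TangentSpace 𝓘(ℂ) x) ℂ U w ∧ ∀ x ∈ U, w x ≠ 0 := by
  have : IsManifold 𝓘(ℂ) (ω + 1) X := inferInstanceAs (IsManifold 𝓘(ℂ) ω X)
  obtain ⟨a, ha⟩ : ∃ a : TangentSpace 𝓘(ℂ) x₀, a ≠ 0 := exists_ne (0 : ℂ)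
  obtain ⟨U, w, hU, hx₀, hw, rfl⟩ :=
    exists_isHolSection_eq (F := ℂ) (E := fun x : X ↦ TangentSpace 𝓘(ℂ) x) a
  have hli := eventually_linearIndependent (e := fun _ : Unit ↦ w)
    (fun _ ↦ hw.isHolSectionAt hU hx₀) (linearIndependent_unique_iff.2 ha)
  obtain ⟨W, hW, hWo, hxW⟩ := eventually_nhds_iff.1 hli
  exact ⟨U ∩ W, w, hU.inter hWo, ⟨hx₀, hxW⟩, hw.mono Set.inter_subset_left,
    fun x hx ↦ linearIndependent_unique_iff.1 (hW x hx.2)⟩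

theorem IsHolConnection.isHolSection_apply {D : CovariantDerivative 𝓘(ℂ) F E}
    (hD : IsHolConnection F D) {U : Set X} (hU : IsOpen U) {s : Π x, E x}
    (hs : IsHolSection F U s) {w : Π x : X, TangentSpace 𝓘(ℂ) x}
    (hw : IsHolSection (E := fun x : X ↦ TangentSpace 𝓘(ℂ) x) ℂ U w) :
    IsHolSection F U fun x ↦ D s x (w x) :=
  ContMDiffOn.clm_bundle_apply (F₁ := ℂ) (E₁ := fun x : X ↦ TangentSpace 𝓘(ℂ) x)
    ((hD U hU).contMDiff hs) hw

theorem IsHolConnection.exists_isDerivativeTower {D : CovariantDerivative 𝓘(ℂ) F E}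
    (hD : IsHolConnection F D) {V : Π x, Submodule ℂ (E x)} (hV : IsHolSubbundle F V) (x₀ : X) :
    ∃ (U : Set X) (w : Π x : X, TangentSpace 𝓘(ℂ) x) (r : ℕ) (e : ℕ → Fin r → Π x, E x),
      x₀ ∈ U ∧ IsDerivativeTower D V U w e := by
  obtain ⟨U₁, hU₁, hx₁, r, s, hs, hframe⟩ := hV x₀
  obtain ⟨U₂, w, hU₂, hx₂, hw, hne⟩ := exists_vectorField x₀
  let e : ℕ → Fin r → Π x, E x := fun j ↦ Nat.rec s (fun _ t i x ↦ D (t i) x (w x)) j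
  refine ⟨U₁ ∩ U₂, w, r, e, ⟨hx₁, hx₂⟩, hU₁.inter hU₂, fun x hx ↦ hne x hx.2, fun j ↦ ?_,
    fun _ _ _ _ ↦ rfl, fun x hx ↦ (hframe x hx.1).1, fun x hx ↦ (hframe x hx.1).2⟩
  induction j with
  | zero => exact fun i ↦ (hs i).mono Set.inter_subset_left
  | succ j ih =>
    exact fun i ↦ hD.isHolSection_apply (hU₁.inter hU₂) (ih i) (hw.mono Set.inter_subset_right)

end HolConnection

section ParallelForm

variable {X : Type*} [TopologicalSpace X] [ChartedSpace ℂ X]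
  {F : Type*} [NormedAddCommGroup F] [NormedSpace ℂ F]
  {E : X → Type*} [TopologicalSpace (TotalSpace F E)]
  [∀ x, AddCommGroup (E x)] [∀ x, Module ℂ (E x)] [∀ x, TopologicalSpace (E x)]
  [∀ x, IsTopologicalAddGroup (E x)] [∀ x, ContinuousSMul ℂ (E x)]
  [FiberBundle F E] [VectorBundle ℂ F E]
  {D : CovariantDerivative 𝓘(ℂ) F E} {B : Π x, E x →L[ℂ] E x →L[ℂ] ℂ}

/-- `B` is a holomorphic family of bilinear forms preserved by the connection `D`. -/
structure IsParallelForm (D : CovariantDerivative 𝓘(ℂ) F E) (B : Π x, E x →L[ℂ] E x →L[ℂ] ℂ) :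
    Prop where
  holomorphic : IsHolBilinForm F B
  compatible : ∀ (U : Set X) (s t : Π x, E x), IsOpen U → IsHolSection F U s →
    IsHolSection F U t → ∀ x ∈ U, ∀ v : TangentSpace 𝓘(ℂ) x,
      mvfderiv 𝓘(ℂ) (fun y ↦ B y (s y) (t y)) x v = B x (D s x v) (t x) + B x (s x) (D t x v)

/-- The image in `E*` of a family of subspaces of `E` under `a ↦ B(a, ·)`. -/
def mapFlat (B : Π x, E x →L[ℂ] E x →L[ℂ] ℂ) (V : Π x, Submodule ℂ (E x)) (x : X) :
    Submodule ℂ (DualBundle E x) :=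
  (V x).map (B x : E x →ₗ[ℂ] DualBundle E x)

omit [TopologicalSpace X] [ChartedSpace ℂ X] [∀ x, IsTopologicalAddGroup (E x)]
  [∀ x, ContinuousSMul ℂ (E x)] in
theorem frameSpan_flat {ρ : Type*} (e : ℕ → ρ → Π x, E x) (k : ℕ) (x : X) :
    frameSpan (fun j i ↦ flat B (e j i)) k x = mapFlat B (frameSpan e k) x := by
  rw [mapFlat, frameSpan, frameSpan, Submodule.map_span, ← Set.range_comp]
  rfl

section Dual

variable [FiniteDimensional ℂ F] [ContMDiffVectorBundle ω F E 𝓘(ℂ)]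
  {V : Π x, Submodule ℂ (E x)} {U : Set X}

theorem IsParallelForm.dualConnection_flat (hB : IsParallelForm D B) (hU : IsOpen U)
    {s : Π x, E x} (hs : IsHolSection F U s) {x : X} (hx : x ∈ U) (v : TangentSpace 𝓘(ℂ) x) :
    dualConnection D (flat B s) x v = B x (D s x v) := by
  refine ContinuousLinearMap.ext fun a ↦ ?_
  obtain ⟨U', t, hU', hx', ht, rfl⟩ := exists_isHolSection_eq (F := F) a
  have hcompat := hB.compatible (U ∩ U') s t (hU.inter hU') (hs.mono Set.inter_subset_left)
    (ht.mono Set.inter_subset_right) x ⟨hx, hx'⟩ v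
  refine (dualConnection_apply D
    ((hB.holomorphic.isHolSection_flat hs).isHolSectionAt hU hx).mdifferentiableAt
    (ht.isHolSectionAt hU' hx').mdifferentiableAt v).trans ?_
  exact sub_eq_iff_eq_add.2 hcompat

theorem IsDerivativeTower.map_flat {ρ : Type*} {w : Π x : X, TangentSpace 𝓘(ℂ) x}
    {e : ℕ → ρ → Π x, E x} (h : IsDerivativeTower D V U w e) (hB : IsParallelForm D B)
    (hinj : ∀ x, Function.Injective (B x)) :
    IsDerivativeTower (dualConnection D) (mapFlat B V) U w fun j i ↦ flat B (e j i) where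
  isOpen := h.isOpen
  ne_zero := h.ne_zero
  isHolSection j i := hB.holomorphic.isHolSection_flat (h.isHolSection j i)
  deriv j i x hx := by
    rw [hB.dualConnection_flat h.isOpen (h.isHolSection j i) hx, ← h.deriv j i x hx]
    rfl
  linearIndependent x hx :=
    (h.linearIndependent x hx).map' (B x : E x →ₗ[ℂ] DualBundle E x)
      (LinearMap.ker_eq_bot.2 (hinj x))
  span x hx := by
    rw [← frameSpan_zero (e := fun j i ↦ flat B (e j i)), frameSpan_flat, mapFlat, frameSpan_zero,
      h.span x hx, mapFlat]

variable {N k : ℕ}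

theorem HasIndependentTowers.map_flat (h : HasIndependentTowers D V N) (hB : IsParallelForm D B)
    (hinj : ∀ x, Function.Injective (B x)) :
    HasIndependentTowers (dualConnection D) (mapFlat B V) N := fun x₀ ↦
  let ⟨U, w, r, _, hx₀, he, hli⟩ := h x₀
  ⟨U, w, r, _, hx₀, he.map_flat hB hinj, fun x hx ↦
    (hli x hx).map' (B x : E x →ₗ[ℂ] DualBundle E x) (LinearMap.ker_eq_bot.2 (hinj x))⟩

theorem HasIndependentTowers.iterSaturation_mapFlat (h : HasIndependentTowers D V N)
    (hB : IsParallelForm D B) (hinj : ∀ x, Function.Injective (B x)) (hk : k ≤ N) :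
    iterSaturation (F →L[ℂ] ℂ) (dualConnection D) k (mapFlat B V) =
      mapFlat B (iterSaturation F D k V) := by
  funext x
  obtain ⟨U, w, r, e, hx, he, hli⟩ := h x
  rw [(h.map_flat hB hinj).iterSaturation_eq_frameSpan hk (he.map_flat hB hinj)
    (fun y hy ↦ (hli y hy).map' (B y : E y →ₗ[ℂ] DualBundle E y)
      (LinearMap.ker_eq_bot.2 (hinj y))) hx, frameSpan_flat, mapFlat,
    mapFlat, h.iterSaturation_eq_frameSpan hk he hli hx]

end Dual

namespace IsDerivativeTower

variable {V : Π x, Submodule ℂ (E x)} {U : Set X} {ρ : Type*}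
  {w : Π x : X, TangentSpace 𝓘(ℂ) x} {e : ℕ → ρ → Π x, E x} {N : ℕ} {x : X}

theorem bilinForm_succ_left (h : IsDerivativeTower D V U w e) (hB : IsParallelForm D B)
    {j k : ℕ} {i l : ρ} (hzero : ∀ y ∈ U, B y (e j i y) (e k l y) = 0) (hx : x ∈ U) :
    B x (e (j + 1) i x) (e k l x) = -B x (e j i x) (e (k + 1) l x) := by
  have hconst : (fun y ↦ B y (e j i y) (e k l y)) =ᶠ[𝓝 x] fun _ ↦ 0 :=
    Filter.eventuallyEq_of_mem (h.isOpen.mem_nhds hx) hzero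
  have hderiv : mvfderiv 𝓘(ℂ) (fun y ↦ B y (e j i y) (e k l y)) x (w x) = 0 := by
    have hcongr : mvfderiv 𝓘(ℂ) (fun y ↦ B y (e j i y) (e k l y)) x =
        mvfderiv 𝓘(ℂ) (fun _ ↦ (0 : ℂ)) x := by
      simp only [mvfderiv, hconst.mfderiv_eq]
      rfl
    rw [hcongr, mvfderiv_const, zero_apply]
  rw [h.deriv j i x hx, h.deriv k l x hx, eq_neg_iff_add_eq_zero, ← hderiv]
  exact (hB.compatible U (e j i) (e k l) h.isOpen (h.isHolSection j i) (h.isHolSection k l)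
    x hx (w x)).symm

theorem bilinForm_antidiagonal (h : IsDerivativeTower D V U w e) (hB : IsParallelForm D B)
    (hzero : ∀ j k, j + k < N → ∀ i l, ∀ y ∈ U, B y (e j i y) (e k l y) = 0) (hx : x ∈ U)
    {j k : ℕ} (hjk : j + k = N) (i l : ρ) :
    B x (e j i x) (e k l x) = (-1) ^ j * B x (e 0 i x) (e N l x) := by
  induction j generalizing k with
  | zero => rw [pow_zero, one_mul, ← hjk, zero_add]
  | succ j ih =>
    rw [h.bilinForm_succ_left hB (hzero j k (by omega) i l) hx, ih (by omega), pow_succ]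
    ring

theorem linearIndependent_and_disjoint_orthogonal [Fintype ρ] [DecidableEq ρ]
    (h : IsDerivativeTower D V U w e) (hB : IsParallelForm D B)
    (hzero : ∀ j k, j + k < N → ∀ i l, ∀ y ∈ U, B y (e j i y) (e k l y) = 0) (hx : x ∈ U)
    (hdet : (Matrix.of fun i l ↦ B x (e 0 i x) (e N l x)).det ≠ 0) :
    LinearIndependent ℂ (fun p : Fin (N + 1) × ρ ↦ e p.1 p.2 x) ∧
      Disjoint (frameSpan e N x) ((B x).toBilinForm.orthogonal (frameSpan e N x)) := by
  refine (det_gram_ne_zero_iff _ _).1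
    (det_ne_zero_of_antitriangular (fun p q hqp ↦ ?_) fun j ↦ ?_)
  · rw [Fin.lt_def, Fin.val_rev] at hqp
    exact hzero _ _ (by omega) _ _ x hx
  · have hblock : (Matrix.of fun i l ↦ B x (e j i x) (e j.rev l x)) =
        (-1 : ℂ) ^ (j : ℕ) • Matrix.of fun i l ↦ B x (e 0 i x) (e N l x) := by
      ext i l
      exact h.bilinForm_antidiagonal hB hzero hx (by rw [Fin.val_rev]; omega) i l
    change (Matrix.of fun i l ↦ B x (e j i x) (e j.rev l x)).det ≠ 0
    rw [hblock, Matrix.det_smul]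
    exact mul_ne_zero (pow_ne_zero _ (pow_ne_zero _ (by norm_num))) hdet

end IsDerivativeTower

end ParallelForm

section SurjectiveEvaluation

variable {K A A' A'' T : Type*} [Field K] [AddCommGroup A] [Module K A] [AddCommGroup A']
  [Module K A'] [AddCommGroup A''] [Module K A''] [AddCommGroup T] [Module K T] {w : T}

theorem surjective_flip_apply {φ : A →ₗ[K] T →ₗ[K] A'} (hφ : Function.Surjective φ) (hw : w ≠ 0) :
    Function.Surjective (φ.flip w) := fun a ↦ by
  obtain ⟨l, hl⟩ := Module.Projective.exists_dual_eq_one K hw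
  obtain ⟨b, hb⟩ := hφ (l.smulRight a)
  exact ⟨b, by rw [LinearMap.flip_apply, hb, LinearMap.smulRight_apply, hl, one_smul]⟩

theorem surjective_flip_comp_flip {φ : A →ₗ[K] T →ₗ[K] A'} {ψ : A' →ₗ[K] T →ₗ[K] A''}
    (h : Function.Surjective fun a ↦ ψ ∘ₗ φ a) (hw : w ≠ 0) :
    Function.Surjective (ψ.flip w ∘ₗ φ.flip w) :=
  surjective_flip_apply (φ := (ψ.compRight K ∘ₗ φ).flip w) (surjective_flip_apply h hw) hw

theorem span_range_eq_top_of_surjective {ι : Type*} {g : ι → A} {g' : ι → A'} {f : A →ₗ[K] A'}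
    (hf : Function.Surjective f) (hfg : ∀ i, f (g i) = g' i)
    (hg : Submodule.span K (Set.range g) = ⊤) : Submodule.span K (Set.range g') = ⊤ := by
  obtain rfl : f ∘ g = g' := funext hfg
  rw [Set.range_comp, ← Submodule.map_span, hg, Submodule.map_top, LinearMap.range_eq_top.2 hf]

end SurjectiveEvaluation

theorem map_eq_dualAnnihilator_orthogonal {K A : Type*} [Field K] [AddCommGroup A] [Module K A]
    [FiniteDimensional K A] {b : LinearMap.BilinForm K A} (hb : b.Nondegenerate) (hrefl : b.IsRefl)
    (W : Submodule K A) : W.map b = (b.orthogonal W).dualAnnihilator := by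
  ext φ
  obtain ⟨a, rfl⟩ := (b.toDual hb).surjective φ
  calc b.toDual hb a ∈ W.map b ↔ a ∈ W := (b.toDual hb).injective.mem_set_image
    _ ↔ a ∈ b.orthogonal (b.orthogonal W) := by
      rw [LinearMap.BilinForm.orthogonal_orthogonal hb hrefl]
    _ ↔ b.toDual hb a ∈ (b.orthogonal W).dualAnnihilator := by
      rw [LinearMap.BilinForm.mem_orthogonal_iff, Submodule.mem_dualAnnihilator]
      exact forall₂_congr fun c _ ↦ hrefl.eq_iff

section SecondFundamentalForm

variable {X : Type*} [TopologicalSpace X] [ChartedSpace ℂ X]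
  {F : Type*} [NormedAddCommGroup F] [NormedSpace ℂ F]
  {E : X → Type*} [TopologicalSpace (TotalSpace F E)]
  [∀ x, AddCommGroup (E x)] [∀ x, Module ℂ (E x)] [∀ x, TopologicalSpace (E x)]
  [∀ x, IsTopologicalAddGroup (E x)] [∀ x, ContinuousSMul ℂ (E x)]
  [FiberBundle F E] {D : CovariantDerivative 𝓘(ℂ) F E} {V V₁ V₂ V₃ V₄ : Π x, Submodule ℂ (E x)}
  {ρ : Type*} {U : Set X} {w : Π x : X, TangentSpace 𝓘(ℂ) x} {e : ℕ → ρ → Π x, E x}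
  {x : X}

theorem IsSecondFundamentalForm.flip_apply_mkQ
    {φ : quot (V₂ x) (V₁ x) →ₗ[ℂ] TangentSpace 𝓘(ℂ) x →ₗ[ℂ] quot (V₄ x) (V₃ x)}
    (hφ : IsSecondFundamentalForm F D V₁ V₂ V₃ V₄ x φ) (he : IsDerivativeTower D V U w e)
    (hx : x ∈ U) {j : ℕ} {i : ρ} (hmem : ∀ y ∈ U, e j i y ∈ V₂ y)
    (hmem' : e (j + 1) i x ∈ V₄ x) :
    φ.flip (w x) (((V₁ x).submoduleOf (V₂ x)).mkQ ⟨e j i x, hmem x hx⟩) =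
      ((V₃ x).submoduleOf (V₄ x)).mkQ ⟨e (j + 1) i x, hmem'⟩ := by
  obtain ⟨_, happ⟩ := hφ U (e j i) hx he.isOpen (he.isHolSection j i) hmem (w x)
  exact happ.trans (congrArg _ (Subtype.ext (he.deriv j i x hx).symm))

end SecondFundamentalForm

section Quasioper

variable {X : Type*} [TopologicalSpace X] [ChartedSpace ℂ X] [IsManifold 𝓘(ℂ) ω X]
  {F : Type*} [NormedAddCommGroup F] [NormedSpace ℂ F]
  {E : X → Type*} [TopologicalSpace (TotalSpace F E)]
  [∀ x, AddCommGroup (E x)] [∀ x, Module ℂ (E x)] [∀ x, TopologicalSpace (E x)]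
  [∀ x, IsTopologicalAddGroup (E x)] [∀ x, ContinuousSMul ℂ (E x)]
  [FiberBundle F E] [VectorBundle ℂ F E] {n m : ℕ}

namespace GeneralizedQuasioper

theorem fil_mono (Q : GeneralizedQuasioper F E n m) {j k : ℕ} (x : X) (hjk : j ≤ k)
    (hk : k ≤ 2 * m + 1) : Q.Fil j x ≤ Q.Fil k x := by
  induction k, hjk using Nat.le_induction with
  | base => exact le_rfl
  | succ k _ ih => exact (ih (by omega)).trans (Q.isFiltration.mono k (by omega) x)

theorem isSymm (Q : GeneralizedQuasioper F E n m) (x : X) : (Q.B x).toBilinForm.IsSymm :=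
  ⟨Q.isSOStructure.symm x⟩

theorem nondegenerate (Q : GeneralizedQuasioper F E n m) (x : X) :
    (Q.B x).toBilinForm.Nondegenerate :=
  (Q.isSymm x).isRefl.nondegenerate_iff_separatingRight.2 (Q.isSOStructure.nondegenerate x)

theorem form_injective (Q : GeneralizedQuasioper F E n m) (x : X) :
    Function.Injective (Q.B x) :=
  (injective_iff_map_eq_zero _).2 fun a ha ↦
    (Q.nondegenerate x).1 a fun f ↦ congrArg (fun φ : E x →L[ℂ] ℂ ↦ φ f) ha

theorem isParallelForm (Q : GeneralizedQuasioper F E n m) : IsParallelForm Q.D Q.B :=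
  ⟨Q.isSOStructure.holomorphic, Q.isFilteredConnection.compatible⟩

theorem orthogonal_fil_one (hm : 1 ≤ m) (Q : GeneralizedQuasioper F E n m) (x : X) :
    (Q.B x).toBilinForm.orthogonal (Q.Fil 1 x) = Q.Fil (2 * m) x :=
  Submodule.ext (Q.isFiltration.perp 1 hm x)

section Tower

variable {Q : GeneralizedQuasioper F E n m} {ρ : Type*} {U : Set X}
  {w : Π x : X, TangentSpace 𝓘(ℂ) x} {e : ℕ → ρ → Π x, E x} {j k : ℕ} {x : X}

theorem tower_mem_fil (he : IsDerivativeTower Q.D (Q.Fil 1) U w e) (hj : j ≤ 2 * m) (i : ρ) :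
    ∀ x ∈ U, e j i x ∈ Q.Fil (j + 1) x := by
  induction j with
  | zero => exact fun x hx ↦ he.span x hx ▸ Submodule.subset_span ⟨i, rfl⟩
  | succ j ih =>
    intro x hx
    rw [he.deriv j i x hx]
    exact Q.isFilteredConnection.mapsInto (j + 1) (by omega) hj U (e j i) he.isOpen
      (he.isHolSection j i) (ih (by omega)) x hx (w x)

theorem form_tower_eq_zero (he : IsDerivativeTower Q.D (Q.Fil 1) U w e) (hjk : j + k < 2 * m)
    (i l : ρ) (hx : x ∈ U) : Q.B x (e j i x) (e k l x) = 0 := by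
  wlog hj : j + 1 ≤ m generalizing j k i l
  · rw [Q.isSOStructure.symm]
    exact this (by omega) l i (by omega)
  have hperp : e k l x ∈ Q.Fil (2 * m + 1 - (j + 1)) x :=
    Q.fil_mono x (by omega) (by omega) (tower_mem_fil he (by omega) l x hx)
  exact (Q.isFiltration.perp (j + 1) hj x (e k l x)).2 hperp _ (tower_mem_fil he (by omega) i x hx)

theorem span_mkQ_tower_eq_top (hm : 1 ≤ m) (he : IsDerivativeTower Q.D (Q.Fil 1) U w e)
    (hj : j ≤ 2 * m) (hjm : j ≠ m) (hx : x ∈ U) :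
    Submodule.span ℂ (Set.range fun i ↦ ((Q.Fil j x).submoduleOf (Q.Fil (j + 1) x)).mkQ
      ⟨e j i x, tower_mem_fil he hj i x hx⟩) = ⊤ := by
  induction j using Nat.strong_induction_on with
  | _ j ih =>
    obtain _ | j := j
    · exact span_range_eq_top_of_surjective (Submodule.mkQ_surjective _) (fun _ ↦ rfl)
        ((Submodule.span_range_subtype_eq_top_iff _ _).2 (he.span x hx))
    obtain rfl | hjm' := eq_or_ne j m
    -- `F_{m+1} / F_m` is too big to be spanned, so step over it with the composite isomorphism.
    · obtain ⟨k, rfl⟩ : ∃ k, j = k + 1 := Nat.exists_eq_add_of_le' hm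
      obtain ⟨φ, ψ, hφ, hψ, hbij⟩ := Q.isFilteredConnection.second_comp_iso x
      refine span_range_eq_top_of_surjective
        (surjective_flip_comp_flip hbij.surjective (he.ne_zero x hx)) (fun i ↦ ?_)
        (ih k (by omega) (by omega) (by omega))
      exact (congrArg (ψ.flip (w x)) (hφ.flip_apply_mkQ he hx (tower_mem_fil he (by omega) i)
        (tower_mem_fil he (by omega) i x hx))).trans
        (hψ.flip_apply_mkQ he hx (tower_mem_fil he (by omega) i) (tower_mem_fil he hj i x hx))
    · obtain ⟨φ, hφ, hbij⟩ := Q.isFilteredConnection.second_iso (j + 1) (by omega) hj hjm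
        (by omega) x
      exact span_range_eq_top_of_surjective
        (surjective_flip_apply hbij.surjective (he.ne_zero x hx))
        (fun i ↦ hφ.flip_apply_mkQ he hx (tower_mem_fil he (by omega) i)
          (tower_mem_fil he hj i x hx))
        (ih j (by omega) (by omega) hjm')

theorem det_form_tower_ne_zero [Fintype ρ] [DecidableEq ρ] (hm : 1 ≤ m)
    (he : IsDerivativeTower Q.D (Q.Fil 1) U w e) (hx : x ∈ U) :
    (Matrix.of fun i l ↦ Q.B x (e 0 i x) (e (2 * m) l x)).det ≠ 0 := by
  intro hdet
  obtain ⟨c, hc, hcM⟩ := Matrix.exists_vecMul_eq_zero_iff.2 hdet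
  set u := ∑ i, c i • e 0 i x with hu
  have hu_mem : u ∈ Q.Fil 1 x :=
    Submodule.sum_mem _ fun i _ ↦ Submodule.smul_mem _ _ (tower_mem_fil he (Nat.zero_le _) i x hx)
  have hker : Q.Fil (2 * m + 1) x ≤ LinearMap.ker ((Q.B x).toBilinForm u) := by
    refine (le_sup_span_of_span_quotient_eq_top
      (span_mkQ_tower_eq_top hm he le_rfl (by omega) hx)).trans (sup_le (fun a ha ↦ ?_)
      (Submodule.span_le.2 (Set.range_subset_iff.2 fun l ↦ ?_)))
    · exact (Q.orthogonal_fil_one hm x ▸ ha) u hu_mem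
    · simpa [hu, Matrix.vecMul, dotProduct] using congrFun hcM l
  have hu_zero : u = 0 := (Q.nondegenerate x).1 u fun a ↦
    hker (Q.isFiltration.top x ▸ Submodule.mem_top)
  exact hc (funext (Fintype.linearIndependent_iff.1 (he.linearIndependent x hx) c hu_zero))

theorem linearIndependent_and_disjoint_orthogonal [Finite ρ] (hm : 1 ≤ m)
    (he : IsDerivativeTower Q.D (Q.Fil 1) U w e) (hx : x ∈ U) :
    LinearIndependent ℂ (fun p : Fin (2 * m + 1) × ρ ↦ e p.1 p.2 x) ∧
      Disjoint (frameSpan e (2 * m) x)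
        ((Q.B x).toBilinForm.orthogonal (frameSpan e (2 * m) x)) := by
  classical
  cases nonempty_fintype ρ
  exact he.linearIndependent_and_disjoint_orthogonal Q.isParallelForm
    (fun _ _ hjk i l _ hy ↦ form_tower_eq_zero he hjk i l hy) hx (det_form_tower_ne_zero hm he hx)

end Tower

theorem hasIndependentTowers (hm : 1 ≤ m) (Q : GeneralizedQuasioper F E n m) :
    HasIndependentTowers Q.D (Q.Fil 1) (2 * m) := fun x₀ ↦
  let ⟨U, w, r, e, hx₀, he⟩ := Q.isFilteredConnection.holomorphic.exists_isDerivativeTower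
    (Q.isFiltration.subbundle 1 (by omega)) x₀
  ⟨U, w, r, e, hx₀, he, fun _ hx ↦ (linearIndependent_and_disjoint_orthogonal hm he hx).1⟩

variable [FiniteDimensional ℂ F]

theorem dualFil_one (hm : 1 ≤ m) (Q : GeneralizedQuasioper F E n m) :
    Q.dualFil 1 = mapFlat Q.B (Q.Fil 1) := by
  funext x
  have := finiteDimensional_fiber (E := E) F x
  ext φ
  calc φ ∈ Q.dualFil 1 x ↔ (φ : E x →ₗ[ℂ] ℂ) ∈ (Q.Fil (2 * m) x).dualAnnihilator := by
        rw [dualFil, LinearMap.ker_comp, ← Submodule.dualRestrict_ker_eq_dualAnnihilator]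
        rfl
    _ ↔ (φ : E x →ₗ[ℂ] ℂ) ∈ (Q.Fil 1 x).map (Q.B x).toBilinForm := by
        rw [map_eq_dualAnnihilator_orthogonal (Q.nondegenerate x) (Q.isSymm x).isRefl,
          Q.orthogonal_fil_one hm]
    _ ↔ φ ∈ mapFlat Q.B (Q.Fil 1) x :=
        exists_congr fun a ↦ and_congr_right fun _ ↦ ContinuousLinearMap.coe_inj

variable [ContMDiffVectorBundle ω F E 𝓘(ℂ)]

theorem disjoint_bundleF_orthogonal (hm : 1 ≤ m) (Q : GeneralizedQuasioper F E n m) (x : X) :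
    Disjoint (Q.bundleF x) ((Q.B x).toBilinForm.orthogonal (Q.bundleF x)) := by
  obtain ⟨U, w, r, e, hx, he, hli⟩ := Q.hasIndependentTowers hm x
  rw [bundleF, (Q.hasIndependentTowers hm).iterSaturation_eq_frameSpan le_rfl he hli hx]
  exact (linearIndependent_and_disjoint_orthogonal hm he hx).2

theorem hasIndependentTowers_dual (hm : 1 ≤ m) (Q : GeneralizedQuasioper F E n m) :
    HasIndependentTowers Q.dualD (Q.dualFil 1) (2 * m) := by
  rw [dualD, Q.dualFil_one hm]
  exact (Q.hasIndependentTowers hm).map_flat Q.isParallelForm Q.form_injective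

theorem bundleG_eq_mapFlat (hm : 1 ≤ m) (Q : GeneralizedQuasioper F E n m) :
    Q.bundleG = mapFlat Q.B Q.bundleF := by
  rw [bundleG, dualD, Q.dualFil_one hm]
  exact (Q.hasIndependentTowers hm).iterSaturation_mapFlat Q.isParallelForm Q.form_injective
    le_rfl

theorem bundleS_eq_orthogonal (hm : 1 ≤ m) (Q : GeneralizedQuasioper F E n m) :
    Q.bundleS = fun x ↦ (Q.B x).toBilinForm.orthogonal (Q.bundleF x) := by
  funext x
  ext a
  rw [bundleS, Submodule.mem_comap, Submodule.range_dualMap_mkQ_eq, Submodule.mem_dualAnnihilator,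
    Q.bundleG_eq_mapFlat hm]
  exact Set.forall_mem_image

end GeneralizedQuasioper

end Quasioper

end SOQuasioper

end

theorem lemma3p2_general
    {X : Type*} [TopologicalSpace X] [ChartedSpace ℂ X] [IsManifold 𝓘(ℂ) ω X]
    {F : Type*} [NormedAddCommGroup F] [NormedSpace ℂ F] [FiniteDimensional ℂ F]
    {E : X → Type*} [TopologicalSpace (TotalSpace F E)]
    [∀ x, AddCommGroup (E x)] [∀ x, Module ℂ (E x)] [∀ x, TopologicalSpace (E x)]
    [∀ x, IsTopologicalAddGroup (E x)] [∀ x, ContinuousSMul ℂ (E x)]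
    [FiberBundle F E] [VectorBundle ℂ F E] [ContMDiffVectorBundle ω F E 𝓘(ℂ)]
    {n m : ℕ} (hm : 1 ≤ m)
    (Q : SOQuasioper.GeneralizedQuasioper F E n m) :
    (∀ k < 2 * m, IsLeast
      (SOQuasioper.saturations F Q.D (SOQuasioper.iterSaturation F Q.D k (Q.Fil 1)))
      (SOQuasioper.iterSaturation F Q.D (k + 1) (Q.Fil 1))) ∧
    (∀ k < 2 * m, IsLeast
      (SOQuasioper.saturations (F →L[ℂ] ℂ) Q.dualD
        (SOQuasioper.iterSaturation (F →L[ℂ] ℂ) Q.dualD k (Q.dualFil 1)))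
      (SOQuasioper.iterSaturation (F →L[ℂ] ℂ) Q.dualD (k + 1) (Q.dualFil 1))) ∧
    SOQuasioper.IsHolDirectSum F Q.bundleF Q.bundleS ∧
    (∀ x, ∀ a ∈ Q.bundleF x, ∀ b ∈ Q.bundleS x, Q.B x a b = 0) := by
  have hF := Q.hasIndependentTowers hm
  refine ⟨fun _ hk ↦ hF.isLeast_iterSaturation_succ hk,
    fun _ hk ↦ (Q.hasIndependentTowers_dual hm).isLeast_iterSaturation_succ hk, ?_⟩
  rw [Q.bundleS_eq_orthogonal hm]
  exact ⟨(hF.isHolSubbundle_iterSaturation le_rfl).isHolDirectSum_orthogonal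
    Q.isSOStructure.holomorphic (fun x ↦ (Q.isSymm x).isRefl) (Q.disjoint_bundleF_orthogonal hm),
    fun x a ha b hb ↦ hb a ha⟩

theorem lemma3p2
    {X : Type*} [TopologicalSpace X] [T2Space X] [CompactSpace X] [ConnectedSpace X]
    [ChartedSpace ℂ X] [IsManifold 𝓘(ℂ) ω X]
    {F : Type*} [NormedAddCommGroup F] [NormedSpace ℂ F] [FiniteDimensional ℂ F]
    {E : X → Type*} [TopologicalSpace (TotalSpace F E)]
    [∀ x, AddCommGroup (E x)] [∀ x, Module ℂ (E x)] [∀ x, TopologicalSpace (E x)]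
    [∀ x, IsTopologicalAddGroup (E x)] [∀ x, ContinuousSMul ℂ (E x)]
    [FiberBundle F E] [VectorBundle ℂ F E] [ContMDiffVectorBundle ω F E 𝓘(ℂ)]
    {n m : ℕ} (hn : 2 ≤ n) (hm : 2 ≤ m)
    (Q : SOQuasioper.GeneralizedQuasioper F E n m) :
    -- the iterated minimal saturations of `F₁` and `G₁` exist
    (∀ k < 2 * m, IsLeast
      (SOQuasioper.saturations F Q.D (SOQuasioper.iterSaturation F Q.D k (Q.Fil 1)))
      (SOQuasioper.iterSaturation F Q.D (k + 1) (Q.Fil 1))) ∧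
    (∀ k < 2 * m, IsLeast
      (SOQuasioper.saturations (F →L[ℂ] ℂ) Q.dualD
        (SOQuasioper.iterSaturation (F →L[ℂ] ℂ) Q.dualD k (Q.dualFil 1)))
      (SOQuasioper.iterSaturation (F →L[ℂ] ℂ) Q.dualD (k + 1) (Q.dualFil 1))) ∧
    -- `E = 𝔽 ⊕ 𝒮` as holomorphic vector bundles
    SOQuasioper.IsHolDirectSum F Q.bundleF Q.bundleS ∧
    -- the decomposition is orthogonal
    (∀ x, ∀ a ∈ Q.bundleF x, ∀ b ∈ Q.bundleS x, Q.B x a b = 0) :=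
  lemma3p2_general (by omega) Q
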